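/- **Setting.** Messages are built from variables, located aliases and the function symbols $\langle\cdot,\cdot\rangle$, $\mathrm{fst}$, $\mathrm{snd}$, $\{\cdot\}_{\cdot}$, $\mathrm{dec}(\cdot,\cdot)$. A located alias $\alpha=s\lambda$ is an alias variable $\lambda$ prefixed with a string $s\in\{0,1\}^*$. Let $=_E$ be the least congruence with $\mathrm{fst}\langle M,N\rangle =_E M$, $\mathrm{snd}\langle M,N\rangle =_E N$ and $\mathrm{dec}(\{M\}_K,K)=_E M$. Processes of the applied $\pi$-calculus, containing no aliases, are given by $$P ::= 0 \mid \nu x.P \mid P\,|\,P \mid {!P} \mid [M=N]P \mid \mathtt{if}\ M=N\ \mathtt{then}\ P\ \mathtt{else}\ P \mid G,$$ $$G ::= M(x).P \mid \overline{M}\langle N\rangle.P \mid [M=N]G \mid G+G \mid \nu x.G,$$ and extended processes have the form $A=\nu\vec x.(\sigma\,|\,P)$, with an active substitution $\sigma$ mapping finitely many aliases ($\mathrm{dom}\,A=\mathrm{dom}\,\sigma$) to alias-free messages; everything is taken up to renaming of bound variables. A process $P$ is read as $\mathrm{id}\,|\,P$. The early transitions $A\xrightarrow{\pi}_u A'$ have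 as action $\pi$ a free input $M\,N$, an output $\overline M(\alpha)$ of a message that is stored under the alias $\alpha$, or $\tau$, and as $u$ a location label. A location is $s[t]$ with $s,t\in\{0,1\}^*$, where $s$ records the component of the parallel composition that acts and $t$ the branches of choices taken; $u$ is a location, or for $\tau$ a pair of locations. Channels are compared modulo $=_E$; a match proceeds if its sides are equal modulo $=_E$; if-then-else acts as its $\mathtt{then}$ branch if $M=_EN$ and as its $\mathtt{else}$ branch otherwise, without affecting the location; $!P$ acts as $P\,|\,{!P}$. For extended processes, aliases in the messages of $\pi$ must be in $\mathrm{dom}\,A$ and are replaced by their values, restricted names do not occur in $\pi$, and an output at location $s[t]$ adds to the active substitution a fresh alias $\alpha=s\lambda$. Write $\nu\vec x.(\theta\,|\,P)\vDash M=N$ if $M\theta=_E N\theta$, where $\vec x$ do not occur in $M,N$. **Bisimilarity.** An *$i$-simulation* is a family of relations $\mathcal R^\rho$ on extended processes such that $A\,\mathcal R^\rho B$ implies that $\rho:\mathrm{dom}\,A\to\mathrm{dom}\,B$ is a bijection and: (i) if $A\xrightarrow{\pi}_u A'$ and $\pi$ is not an output, then $B\xrightarrow{\pi\rho}_{u'}B'$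 and $A'\,\mathcal R^\rho B'$ for some $B',u'$; (ii) if $A\xrightarrow{\overline M(\alpha)}_u A'$, then $B\xrightarrow{\overline{M\rho}(\alpha')}_{u'}B'$ and $A'\,\mathcal R^{\rho[\alpha\mapsto\alpha']}B'$ for some $B',u',\alpha'$; (iii) $A\vDash M=N$ iff $B\vDash M\rho=N\rho$, for all $M,N$ whose aliases are in $\mathrm{dom}\,A$. Extended processes $A,B$ are *$i$-bisimilar* if $A\,\mathcal R^{\mathrm{id}}B$ for some $i$-simulation that is symmetric ($A\,\mathcal R^\rho B$ iff $B\,\mathcal R^{\rho^{-1}}A$). **Logic.** Formulas of classical $\mathcal{FM}$ are $\phi::=\mathtt{true}\mid M=N\mid\phi\wedge\phi\mid\neg\phi\mid\langle\pi\rangle\phi$ with $\pi$ of the form $\tau$, $M\,N$ or $\overline M(x)$, the last binding $x$. Equality is interpreted as above and the connectives classically; for $\pi$ not an output, $A\vDash\langle\pi\rangle\phi$ iff $A\xrightarrow{\pi}_u B\vDash\phi$ for some $u,B$; and $A\vDash\langle\overline M(x)\rangle\phi$ iff $A\xrightarrow{\overline M(\alpha)}_u B$ and $B\vDash\phi[\alpha/x]$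 for some $u,B$ and some $\alpha$ not in $\phi$. Write $M\ne N$ for $\neg(M=N)$ and $[\pi]\phi$ for $\neg\langle\pi\rangle\neg\phi$. **Theorem.** Let $c,d,\mathrm{error}$ be distinct (free) variables, and let $$V(c,d,k)=d(nt).\,\nu nr.\,\overline c\langle\{\langle nr,nt\rangle\}_k\rangle,$$ $$P^{\mathrm{error}}(c,d,k)=\nu nt.\,\overline c\langle nt\rangle.\,d(y).\ \mathtt{if}\ nt=\mathrm{snd}(\mathrm{dec}(y,k))\ \mathtt{then}\ \overline c\langle\{\langle nt,\mathrm{fst}(\mathrm{dec}(y,k))\rangle\}_k\rangle\ \mathtt{else}\ \overline c\langle\mathrm{error}\rangle,$$ $$\mathrm{System}={!\nu k.!}\big(V(c,d,k)\,|\,P^{\mathrm{error}}(c,d,k)\big),\qquad \mathrm{Spec}={!\nu k.}\big(V(c,d,k)\,|\,P^{\mathrm{error}}(c,d,k)\big).$$ Then $\mathrm{System}$ and $\mathrm{Spec}$ are not $i$-bisimilar. Moreover, for every variable $z\notin\{c,d,\mathrm{error}\}$, $\mathrm{System}\vDash\psi$ and $\mathrm{Spec}\nvDash\psi$, where $$\psi=\langle\overline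 c(nt_1)\rangle\langle d\,nt_1\rangle\langle d\,nt_1\rangle\langle\overline c(u_1)\rangle\langle\overline c(u_2)\rangle\Big(u_1\ne\mathrm{error}\wedge u_2\ne\mathrm{error}\wedge\chi\wedge\phi_{u_1}\wedge\phi_{u_2}\Big),$$ $$\chi=\langle d\,z\rangle\langle\overline c(e)\rangle\big(e=\mathrm{error}\wedge[d\,z][\overline c(v)](v\ne\mathrm{error})\big),\qquad \phi_{u}=\langle d\,u\rangle\langle\overline c(w)\rangle\big(w\ne\mathrm{error}\wedge[d\,z][\overline c(v)](v\ne\mathrm{error})\big).$$ -/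

import Mathlib

namespace APi

/-- Messages over a set `X` of atoms, for the signature of pairs and symmetric encryption:
`enc M K` is `{M}_K` and `dec M K` is decryption of `M` with the key `K`. -/
inductive Msg (X : Type) : Type
  | var : X → Msg X
  | pair : Msg X → Msg X → Msg X
  | fst : Msg X → Msg X
  | snd : Msg X → Msg X
  | enc : Msg X → Msg X → Msg X
  | dec : Msg X → Msg X → Msg X

namespace Msg

/-- Simultaneous substitution of messages for atoms. -/
def bind {X Y : Type} (f : X → Msg Y) : Msg X → Msg Y
  | var x => f x
  | pair M N => pair (bind f M) (bind f N)
  | fst M => fst (bind f M)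
  | snd M => snd (bind f M)
  | enc M N => enc (bind f M) (bind f N)
  | dec M N => dec (bind f M) (bind f N)

/-- Renaming of atoms. -/
def map {X Y : Type} (f : X → Y) (M : Msg X) : Msg Y := M.bind (fun x => var (f x))

/-- The set of atoms occurring in a message. -/
def atoms {X : Type} : Msg X → Set X
  | var x => {x}
  | pair M N => atoms M ∪ atoms N
  | fst M => atoms M
  | snd M => atoms M
  | enc M N => atoms M ∪ atoms N
  | dec M N => atoms M ∪ atoms N

end Msg

/-- Equality modulo the equational theory `E` of pairs and symmetric encryption: the least
congruence with `fst (M, N) = M`, `snd (M, N) = N` and `dec {M}_K K = M`. -/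
inductive EqE {X : Type} : Msg X → Msg X → Prop
  | refl (M : Msg X) : EqE M M
  | symm {M N : Msg X} : EqE M N → EqE N M
  | trans {M N K : Msg X} : EqE M N → EqE N K → EqE M K
  | pair {M M' N N' : Msg X} : EqE M M' → EqE N N' → EqE (.pair M N) (.pair M' N')
  | fst {M M' : Msg X} : EqE M M' → EqE (.fst M) (.fst M')
  | snd {M M' : Msg X} : EqE M M' → EqE (.snd M) (.snd M')
  | enc {M M' N N' : Msg X} : EqE M M' → EqE N N' → EqE (.enc M N) (.enc M' N')
  | dec {M M' N N' : Msg X} : EqE M M' → EqE N N' → EqE (.dec M N) (.dec M' N')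
  | fst_pair (M N : Msg X) : EqE (.fst (.pair M N)) M
  | snd_pair (M N : Msg X) : EqE (.snd (.pair M N)) N
  | dec_enc (M K : Msg X) : EqE (.dec (.enc M K) K) M

/-! ### Processes

Variables are natural numbers, in the style of de Bruijn: a binder (`ν x.`, input, or the output
modality of the logic below) binds index `0` of its body, and a variable `i` seen from outside
the binder is `i + 1` inside. Terms are therefore identified up to renaming of bound variables,
and the freshness side conditions of the calculus become shifts of indices. -/

mutual

/-- Processes. -/
inductive Proc : Type
  | nil : Proc
  | nu : Proc → Proc
  | par : Proc → Proc → Proc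
  | guarded : Guarded → Proc
  | bang : Proc → Proc
  | mat : Msg ℕ → Msg ℕ → Proc → Proc
  /-- `cond M N P Q` is `if M = N then P else Q`. -/
  | cond : Msg ℕ → Msg ℕ → Proc → Proc → Proc

/-- Guarded processes. `inp K P` is `K(x).P`, with `x` the index `0` of `P`, and `out K N P` is
the output prefix that sends `N` on `K` and continues as `P`. -/
inductive Guarded : Type
  | inp : Msg ℕ → Proc → Guarded
  | out : Msg ℕ → Msg ℕ → Proc → Guarded
  | mat : Msg ℕ → Msg ℕ → Guarded → Guarded
  | sum : Guarded → Guarded → Guarded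
  | nu : Guarded → Guarded

end

/-- A substitution carried under a binder. -/
def up (f : ℕ → Msg ℕ) : ℕ → Msg ℕ
  | 0 => .var 0
  | i + 1 => (f i).map Nat.succ

mutual

/-- Capture-avoiding simultaneous substitution of messages for the free variables. -/
def Proc.subst (f : ℕ → Msg ℕ) : Proc → Proc
  | .nil => .nil
  | .nu P => .nu (P.subst (up f))
  | .par P Q => .par (P.subst f) (Q.subst f)
  | .guarded G => .guarded (G.subst f)
  | .bang P => .bang (P.subst f)
  | .mat M N P => .mat (M.bind f) (N.bind f) (P.subst f)
  | .cond M N P Q => .cond (M.bind f) (N.bind f) (P.subst f) (Q.subst f)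

/-- Capture-avoiding simultaneous substitution of messages for the free variables. -/
def Guarded.subst (f : ℕ → Msg ℕ) : Guarded → Guarded
  | .inp K P => .inp (K.bind f) (P.subst (up f))
  | .out K N P => .out (K.bind f) (N.bind f) (P.subst f)
  | .mat M N G => .mat (M.bind f) (N.bind f) (G.subst f)
  | .sum G H => .sum (G.subst f) (H.subst f)
  | .nu G => .nu (G.subst (up f))

end

/-- Renaming of the free variables. -/
def Proc.rename (r : ℕ → ℕ) (P : Proc) : Proc := P.subst (fun i => .var (r i))

/-- `P` placed under `n` further binders, none of which it mentions. -/
def Proc.shift (n : ℕ) (P : Proc) : Proc := P.rename (· + n)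

/-- `P` with `N` substituted for the variable of the binder that has just been removed. -/
def Proc.inst (N : Msg ℕ) (P : Proc) : Proc :=
  P.subst (fun i => match i with
    | 0 => N
    | j + 1 => .var j)

/-! ### Aliases, active substitutions and extended processes -/

/-- A located alias: an alias variable prefixed with a string over `{0, 1}`
(`false` is `0` and `true` is `1`). -/
structure Alias : Type where
  pre : List Bool
  name : ℕ
deriving DecidableEq

/-- Messages in which aliases may occur besides variables. -/
abbrev Recipe : Type := Msg (ℕ ⊕ Alias)

/-- The aliases of a message. -/
def Msg.fal (M : Recipe) : Set Alias := {a | Sum.inr a ∈ M.atoms}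

/-- A message without aliases, seen as a message that may contain aliases. -/
def Msg.emb (M : Msg ℕ) : Recipe := M.map Sum.inl

/-- Shift of the variables of a recipe by `n`. -/
def Msg.lift (n : ℕ) (M : Recipe) : Recipe := M.map (Sum.map (· + n) id)

/-- Renaming of the aliases of a recipe. -/
def Msg.ren (ρ : Alias → Alias) (M : Recipe) : Recipe := M.map (Sum.map id ρ)

/-- Active substitutions: finitely many aliases are mapped to messages without aliases, and the
other aliases (those with value `none`) are mapped to themselves. -/
@[ext] structure Frame : Type where
  toFun : Alias → Option (Msg ℕ)
  finite_dom : {a | toFun a ≠ none}.Finite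

namespace Frame

/-- The domain of an active substitution. -/
def dom (σ : Frame) : Set Alias := {a | σ.toFun a ≠ none}

/-- The identity substitution. -/
def idn : Frame := ⟨fun _ => none, by simp⟩

/-- `σ` extended by `a ↦ N`. -/
def update (σ : Frame) (a : Alias) (N : Msg ℕ) : Frame :=
  ⟨Function.update σ.toFun a (some N), (σ.finite_dom.insert a).subset (by
    intro b hb
    by_cases h : b = a
    · exact Or.inl h
    · refine Or.inr ?_
      simpa [Function.update_of_ne h] using hb)⟩

/-- The substitution with domain `{a}` that maps `a` to `N`. -/
def single (a : Alias) (N : Msg ℕ) : Frame := idn.update a N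

/-- `σ` with its messages placed under `n` further binders. -/
def shift (n : ℕ) (σ : Frame) : Frame :=
  ⟨fun a => (σ.toFun a).map (Msg.map (· + n)), σ.finite_dom.subset (by
    intro b hb h
    exact hb (by simp [h]))⟩

/-- The value of an active substitution at an alias. -/
def val (σ : Frame) (a : Alias) : Recipe :=
  match σ.toFun a with
  | some N => N.emb
  | none => .var (.inr a)

end Frame

/-- `M.app σ` is the message `Mσ`. -/
def Msg.app (σ : Frame) (M : Recipe) : Recipe :=
  M.bind (Sum.elim (fun x => .var (.inl x)) σ.val)

/-- The extended process `ν x₁ … xₙ. (σ | P)`, where `n` is `bound`: the indices below `n` in the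
active substitution `frame` and in `proc` are the restricted names, and a variable `i` seen from
outside is `i + n` in them. -/
@[ext] structure Ext : Type where
  bound : ℕ
  frame : Frame
  proc : Proc

/-- The domain of an extended process. -/
def Ext.dom (A : Ext) : Set Alias := A.frame.dom

/-- A process `P` as the extended process `id | P`. -/
def Proc.toExt (P : Proc) : Ext := ⟨0, .idn, P⟩

/-- `ν x. A`. -/
def Ext.nu (A : Ext) : Ext := ⟨A.bound + 1, A.frame, A.proc⟩

/-! ### Labels -/

/-- Early action labels: free input `M N`, output `M̄(α)` and interaction `τ`. -/
inductive Act (X : Type) : Type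
  | inp : Msg X → Msg X → Act X
  | out : Msg X → Alias → Act X
  | tau : Act X

namespace Act

/-- Substitution in the messages of a label (the alias bound by an output is kept). -/
def bind {X Y : Type} (f : X → Msg Y) : Act X → Act Y
  | inp M N => inp (M.bind f) (N.bind f)
  | out M a => out (M.bind f) a
  | tau => tau

/-- Renaming of atoms in the messages of a label. -/
def map {X Y : Type} (f : X → Y) (π : Act X) : Act Y := π.bind (fun x => .var (f x))

/-- The label is an output. -/
def IsOut {X : Type} : Act X → Prop
  | out _ _ => True
  | _ => False

/-- A label without aliases in its messages, seen as one that may contain aliases. -/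
def emb (π : Act ℕ) : Act (ℕ ⊕ Alias) := π.map Sum.inl

/-- Shift of the variables of a label by `n`. -/
def lift (n : ℕ) (π : Act (ℕ ⊕ Alias)) : Act (ℕ ⊕ Alias) := π.map (Sum.map (· + n) id)

/-- Renaming of the aliases in the messages of a label. -/
def ren (ρ : Alias → Alias) (π : Act (ℕ ⊕ Alias)) : Act (ℕ ⊕ Alias) := π.map (Sum.map id ρ)

/-- `π.app σ` is `πσ`. -/
def app (σ : Frame) (π : Act (ℕ ⊕ Alias)) : Act (ℕ ⊕ Alias) :=
  π.bind (Sum.elim (fun x => .var (.inl x)) σ.val)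

end Act

/-- A location `s[t]`. -/
structure Loc : Type where
  pre : List Bool
  branch : List Bool

/-- A location prefixed with `0` or `1`. -/
def Loc.cons (b : Bool) (l : Loc) : Loc := ⟨b :: l.pre, l.branch⟩

/-- Location labels: a location, or a pair of locations. -/
inductive LocLabel : Type
  | one : Loc → LocLabel
  | two : Loc → Loc → LocLabel

/-- A location label prefixed with `0` or `1`. -/
def LocLabel.cons (b : Bool) : LocLabel → LocLabel
  | one l => one (l.cons b)
  | two l l' => two (l.cons b) (l'.cons b)

/-! ### Transitions -/

/-- The root alias with a given alias variable, i.e. with the empty prefix. -/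
def root (l : ℕ) : Alias := ⟨[], l⟩

/-- Transitions of guarded processes. `GStep G π t A` is the transition of `G` to `A` with action
`π` at the location `[t]`. -/
inductive GStep : Guarded → Act ℕ → List Bool → Ext → Prop
  | inp {K M : Msg ℕ} (N : Msg ℕ) {P : Proc} : EqE M K →
      GStep (.inp K P) (.inp M N) [] ⟨0, .idn, P.inst N⟩
  | out {K M N : Msg ℕ} {P : Proc} (l : ℕ) : EqE M K →
      GStep (.out K N P) (.out M (root l)) [] ⟨0, .single (root l) N, P⟩
  | mat {M N : Msg ℕ} {G : Guarded} {π : Act ℕ} {t : List Bool} {A : Ext} :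
      GStep G π t A → EqE M N → GStep (.mat M N G) π t A
  | sumL {G H : Guarded} {π : Act ℕ} {t : List Bool} {A : Ext} :
      GStep G π t A → GStep (.sum G H) π (false :: t) A
  | sumR {G H : Guarded} {π : Act ℕ} {t : List Bool} {A : Ext} :
      GStep H π t A → GStep (.sum G H) π (true :: t) A
  | ext {G : Guarded} {π : Act ℕ} {t : List Bool} {A : Ext} :
      GStep G (π.map Nat.succ) t A → GStep (.nu G) π t A.nu

/-- Exchange of the blocks of the first `m` and the next `n` indices. -/
def swapBlocks (m n i : ℕ) : ℕ := if i < m then i + n else if i < m + n then i - m else i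

/-- Transitions of processes: early non-interleaving structural operational semantics, with
events (an action together with a location label) as labels. -/
inductive Step : Proc → Act ℕ → LocLabel → Ext → Prop
  | guarded {G : Guarded} {π : Act ℕ} {t : List Bool} {A : Ext} :
      GStep G π t A → Step (.guarded G) π (.one ⟨[], t⟩) A
  | parL {P Q : Proc} {π : Act ℕ} {u : LocLabel} {m : ℕ} {σ : Frame} {R : Proc} :
      Step P π u ⟨m, σ, R⟩ → Step (.par P Q) π (u.cons false) ⟨m, σ, .par R (Q.shift m)⟩
  | parR {P Q : Proc} {π : Act ℕ} {u : LocLabel} {m : ℕ} {σ : Frame} {R : Proc} :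
      Step Q π u ⟨m, σ, R⟩ → Step (.par P Q) π (u.cons true) ⟨m, σ, .par (P.shift m) R⟩
  | ext {P : Proc} {π : Act ℕ} {u : LocLabel} {A : Ext} :
      Step P (π.map Nat.succ) u A → Step (.nu P) π u A.nu
  | mat {M N : Msg ℕ} {P : Proc} {π : Act ℕ} {u : LocLabel} {A : Ext} :
      Step P π u A → EqE M N → Step (.mat M N P) π u A
  | condThen {M N : Msg ℕ} {P Q : Proc} {π : Act ℕ} {u : LocLabel} {A : Ext} :
      EqE M N → Step P π u A → Step (.cond M N P Q) π u A
  | condElse {M N : Msg ℕ} {P Q : Proc} {π : Act ℕ} {u : LocLabel} {A : Ext} :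
      ¬ EqE M N → Step Q π u A → Step (.cond M N P Q) π u A
  | bang {P : Proc} {π : Act ℕ} {u : LocLabel} {A : Ext} :
      Step (.par P (.bang P)) π u A → Step (.bang P) π u A
  /-- `P` extrudes the `n` names `y⃗` with the message `N`, which `Q` receives while creating the
  `m` names `w⃗`; the result is `ν y⃗, w⃗. (id | P' | Q')`. -/
  | closeL {P Q P' Q' : Proc} {M N : Msg ℕ} {l : ℕ} {l₀ l₁ : Loc} {n m : ℕ} :
      Step P (.out M (root l)) (.one l₀) ⟨n, .single (root l) N, P'⟩ →
      Step (Q.shift n) (.inp (M.map (· + n)) N) (.one l₁) ⟨m, .idn, Q'⟩ →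
      Step (.par P Q) .tau (.two (l₀.cons false) (l₁.cons true))
        ⟨n + m, .idn, .par (P'.shift m) Q'⟩
  /-- `Q` extrudes the `n` names `w⃗` with the message `N`, which `P` receives while creating the
  `m` names `y⃗`; the result is `ν y⃗, w⃗. (id | P' | Q')`. -/
  | closeR {P Q P' Q' : Proc} {M N : Msg ℕ} {l : ℕ} {l₀ l₁ : Loc} {n m : ℕ} :
      Step Q (.out M (root l)) (.one l₁) ⟨n, .single (root l) N, Q'⟩ →
      Step (P.shift n) (.inp (M.map (· + n)) N) (.one l₀) ⟨m, .idn, P'⟩ →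
      Step (.par P Q) .tau (.two (l₁.cons true) (l₀.cons false))
        ⟨m + n, .idn, .par (P'.rename (swapBlocks m n))
          (Q'.rename (fun i => if i < n then i else i + m))⟩

/-- Transitions of extended processes. The shift by `n` says that the restricted names of the
extended process do not occur in the label. That an instantiated label is the embedding of a
label without aliases says that all its aliases are in the domain of `σ`. -/
inductive Ext.Step : Ext → Act (ℕ ⊕ Alias) → LocLabel → Ext → Prop
  | aliasOut {n : ℕ} {σ : Frame} {P : Proc} {M : Recipe} {M' N : Msg ℕ} {l : ℕ}
      {s t : List Bool} {m : ℕ} {Q : Proc} :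
      (M.lift n).app σ = M'.emb →
      (⟨s, l⟩ : Alias) ∉ σ.dom →
      APi.Step P (.out M' (root l)) (.one ⟨s, t⟩) ⟨m, .single (root l) N, Q⟩ →
      Ext.Step ⟨n, σ, P⟩ (.out M ⟨s, l⟩) (.one ⟨s, t⟩) ⟨n + m, (σ.shift m).update ⟨s, l⟩ N, Q⟩
  | aliasFree {n : ℕ} {σ : Frame} {P : Proc} {π : Act (ℕ ⊕ Alias)} {π' : Act ℕ}
      {u : LocLabel} {m : ℕ} {Q : Proc} :
      (π.lift n).app σ = π'.emb →
      APi.Step P π' u ⟨m, .idn, Q⟩ →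
      Ext.Step ⟨n, σ, P⟩ π u ⟨n + m, σ.shift m, Q⟩

/-! ### Interleaving bisimilarity -/

/-- `A ⊨ M = N`. -/
def Ext.SatEq (A : Ext) (M N : Recipe) : Prop :=
  EqE ((M.lift A.bound).app A.frame) ((N.lift A.bound).app A.frame)

/-- Interleaving simulations. `R ρ A B` is `A R^ρ B`. Only the restriction of `ρ` to `dom A`
matters; it is a bijection onto `dom B`. -/
structure IsISimulation (R : (Alias → Alias) → Ext → Ext → Prop) : Prop where
  bij : ∀ ρ A B, R ρ A B → Set.BijOn ρ A.dom B.dom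
  act : ∀ ρ A B, R ρ A B → ∀ π u A', A.Step π u A' → ¬ π.IsOut →
    ∃ B' u', B.Step (π.ren ρ) u' B' ∧ R ρ A' B'
  out : ∀ ρ A B, R ρ A B → ∀ M a u A', A.Step (.out M a) u A' →
    ∃ B' u' a', B.Step (.out (M.ren ρ) a') u' B' ∧ R (Function.update ρ a a') A' B'
  test : ∀ ρ A B, R ρ A B → ∀ M N : Recipe, M.fal ⊆ A.dom → N.fal ⊆ A.dom →
    (A.SatEq M N ↔ B.SatEq (M.ren ρ) (N.ren ρ))

/-- `R` is symmetric: `A R^ρ B` implies `B R^ρ' A` for every inverse `ρ'` of the bijection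
`ρ` between `dom A` and `dom B`. -/
def IsSymmetric (R : (Alias → Alias) → Ext → Ext → Prop) : Prop :=
  ∀ ρ ρ' A B, R ρ A B → Set.InvOn ρ' ρ A.dom B.dom → R ρ' B A

/-- `A` and `B` are `i`-bisimilar. -/
def IBisimilar (A B : Ext) : Prop :=
  ∃ R : (Alias → Alias) → Ext → Ext → Prop, IsISimulation R ∧ IsSymmetric R ∧ R id A B

/-! ### The modal logic classical `FM` -/

/-- Formulas. `diaInp M N φ` is `⟨M N⟩φ`, `diaTau φ` is `⟨τ⟩φ` and `diaOut M φ` is `⟨M̄(x)⟩φ`,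
with `x` the index `0` of `φ`. -/
inductive Form : Type
  | tru : Form
  | eq : Recipe → Recipe → Form
  | and : Form → Form → Form
  | neg : Form → Form
  | diaInp : Recipe → Recipe → Form → Form
  | diaTau : Form → Form
  | diaOut : Recipe → Form → Form

namespace Form

/-- `M ≠ N`. -/
def ne (M N : Recipe) : Form := neg (eq M N)

/-- `[M N]φ`. -/
def boxInp (M N : Recipe) (φ : Form) : Form := neg (diaInp M N (neg φ))

/-- `[M̄(x)]φ`, with `x` the index `0` of `φ`. -/
def boxOut (M : Recipe) (φ : Form) : Form := neg (diaOut M (neg φ))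

/-- The aliases of a formula. -/
def fal : Form → Set Alias
  | tru => ∅
  | eq M N => M.fal ∪ N.fal
  | and φ ψ => φ.fal ∪ ψ.fal
  | neg φ => φ.fal
  | diaInp M N φ => M.fal ∪ N.fal ∪ φ.fal
  | diaTau φ => φ.fal
  | diaOut M φ => M.fal ∪ φ.fal

/-- `φ` with the variable `k` replaced by the alias `a`, when `k` is the number of binders
between the occurrence and the removed binder; the variables above `k` move down by one. -/
def instAt (a : Alias) : ℕ → Form → Form
  | _, tru => tru
  | k, eq M N => eq (M.map (at_ a k)) (N.map (at_ a k))
  | k, and φ ψ => and (φ.instAt a k) (ψ.instAt a k)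
  | k, neg φ => neg (φ.instAt a k)
  | k, diaInp M N φ => diaInp (M.map (at_ a k)) (N.map (at_ a k)) (φ.instAt a k)
  | k, diaTau φ => diaTau (φ.instAt a k)
  | k, diaOut M φ => diaOut (M.map (at_ a k)) (φ.instAt a (k + 1))
where
  at_ (a : Alias) (k : ℕ) : ℕ ⊕ Alias → ℕ ⊕ Alias
    | .inl i => if i < k then .inl i else if i = k then .inr a else .inl (i - 1)
    | .inr b => .inr b

/-- `φ` with the alias `a` substituted for the variable of the removed output modality. -/
def inst (a : Alias) (φ : Form) : Form := φ.instAt a 0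

/-- The number of connectives. -/
def size : Form → ℕ
  | tru => 0
  | eq _ _ => 0
  | and φ ψ => φ.size + ψ.size + 1
  | neg φ => φ.size + 1
  | diaInp _ _ φ => φ.size + 1
  | diaTau φ => φ.size + 1
  | diaOut _ φ => φ.size + 1

theorem size_instAt (a : Alias) (k : ℕ) (φ : Form) : (φ.instAt a k).size = φ.size := by
  induction φ generalizing k <;> simp_all [instAt, size]

theorem size_inst (a : Alias) (φ : Form) : (φ.inst a).size = φ.size := size_instAt a 0 φ

end Form

/-- Satisfaction `A ⊨ φ`. -/
def Sat (A : Ext) : Form → Prop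
  | .tru => True
  | .eq M N => A.SatEq M N
  | .and φ ψ => Sat A φ ∧ Sat A ψ
  | .neg φ => ¬ Sat A φ
  | .diaInp M N φ => ∃ u B, A.Step (.inp M N) u B ∧ Sat B φ
  | .diaTau φ => ∃ u B, A.Step .tau u B ∧ Sat B φ
  | .diaOut M φ => ∃ a u B, A.Step (.out M a) u B ∧ a ∉ φ.fal ∧ Sat B (φ.inst a)
termination_by φ => φ.size
decreasing_by all_goals simp [Form.size, Form.size_inst]

/-! ### The Feldhofer protocol with an error message, in the minimal unbounded style -/

/-- The verifier `V(c, d, k) = d(nt). ν nr. c̄⟨{(nr, nt)}_k⟩`. -/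
def verifier (c d k : ℕ) : Proc :=
  .guarded (.inp (.var d)
    (.nu (.guarded (.out (.var (c + 2))
      (.enc (.pair (.var 0) (.var 1)) (.var (k + 2))) .nil))))

/-- The prover
`P(c, d, k) = ν nt. c̄⟨nt⟩. d(y). if nt = snd (dec y k) then c̄⟨{(nt, fst (dec y k))}_k⟩ else c̄⟨err⟩`.
Under the two binders, `y` is `0` and `nt` is `1`. -/
def prover (err c d k : ℕ) : Proc :=
  .nu (.guarded (.out (.var (c + 1)) (.var 0) (.guarded (.inp (.var (d + 1))
    (.cond (.var 1) (.snd (.dec (.var 0) (.var (k + 2))))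
      (.guarded (.out (.var (c + 2))
        (.enc (.pair (.var 1) (.fst (.dec (.var 0) (.var (k + 2))))) (.var (k + 2))) .nil))
      (.guarded (.out (.var (c + 2)) (.var (err + 2)) .nil)))))))

/-- `System = !ν k. !(V(c, d, k) | P(c, d, k))`. -/
def system (err c d : ℕ) : Proc :=
  .bang (.nu (.bang (.par (verifier (c + 1) (d + 1) 0) (prover (err + 1) (c + 1) (d + 1) 0))))

/-- `Spec = !ν k. (V(c, d, k) | P(c, d, k))`. -/
def spec (err c d : ℕ) : Proc :=
  .bang (.nu (.par (verifier (c + 1) (d + 1) 0) (prover (err + 1) (c + 1) (d + 1) 0)))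

/-- The variable `i` in a formula. -/
def v (i : ℕ) : Recipe := .var (.inl i)

/-- `[d z][c̄(v)](v ≠ err)`. -/
def noError (err c d z : ℕ) : Form :=
  .boxInp (v d) (v z) (.boxOut (v c) (.ne (v 0) (v (err + 1))))

/-- `⟨d u⟩⟨c̄(w)⟩(w ≠ err ∧ [d z][c̄(v)](v ≠ err))`. -/
def authBranch (err c d z u : ℕ) : Form :=
  .diaInp (v d) (v u) (.diaOut (v c)
    (.and (.ne (v 0) (v (err + 1))) (noError (err + 1) (c + 1) (d + 1) (z + 1))))

/-- `⟨d z⟩⟨c̄(e)⟩(e = err ∧ [d z][c̄(v)](v ≠ err))`. -/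
def errorBranch (err c d z : ℕ) : Form :=
  .diaInp (v d) (v z) (.diaOut (v c)
    (.and (.eq (v 0) (v (err + 1))) (noError (err + 1) (c + 1) (d + 1) (z + 1))))

/-- The attack formula
`⟨c̄(nt₁)⟩⟨d nt₁⟩⟨d nt₁⟩⟨c̄(u₁)⟩⟨c̄(u₂)⟩(u₁ ≠ err ∧ u₂ ≠ err ∧ errorBranch ∧ authBranch u₁ ∧
authBranch u₂)`. In the body, `u₂` is `0`, `u₁` is `1` and `nt₁` is `2`. -/
def attack (err c d z : ℕ) : Form :=
  .diaOut (v c) (.diaInp (v (d + 1)) (v 0) (.diaInp (v (d + 1)) (v 0)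
    (.diaOut (v (c + 1)) (.diaOut (v (c + 2))
      (.and (.ne (v 1) (v (err + 3)))
      (.and (.ne (v 0) (v (err + 3)))
      (.and (errorBranch (err + 3) (c + 3) (d + 3) (z + 3))
      (.and (authBranch (err + 3) (c + 3) (d + 3) (z + 3) 1)
        (authBranch (err + 3) (c + 3) (d + 3) (z + 3) 0)))))))))

end APi

-- Messages, normal forms and inequalities modulo `E`.

namespace APi

namespace Msg

-- The attack rests on counting the error messages that can still be provoked. Give weight one to a
-- prover that awaits its answer and to a prover that holds an answer it will reject (`errors`).
-- Reading a variable never changes the total, since a variable does not decrypt to anything a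
-- prover accepts. An error output lowers it by one, a new nonce raises it by one, and a verifier's
-- answer leaves it alone. Hence `noError` holds exactly when the total is zero, the error branch
-- forces the total to be one, and an authentication branch for `u` taken when the total is not zero
-- needs a waiting prover that accepts `u`.
--
-- In the system, one key serves many sessions: two verifiers with the same key answer the nonce of
-- a single prover, and that prover accepts either answer. In the specification, the first output
-- must be a nonce, which makes the total one. It is one again when the branches are tested, so
-- neither `u₁` nor `u₂` can be a nonce; both are verifiers' answers. Each key has at most one
-- verifier, so the two answers are encrypted under different keys, and a prover accepts an answer
-- only under its own key. The two authentication branches therefore need two distinct waiting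
-- provers, of total weight two, a contradiction.
--
-- To count at all, processes are read as multisets of sequential threads, with the transitions that
-- the formula can observe described in both directions (`Thread.ActIn.step`, `Thread.Repr.actIn`).
-- The counting is in `Thread.ActIn.of_inp`, `Thread.ActIn.of_out` and `Thread.ActIn.areSingle`.
-- Failure of bisimilarity then follows because bisimilar processes satisfy the same alias-free
-- formulas (`IBisimilar.sat`).

theorem bind_bind {X Y Z : Type} (f : X → Msg Y) (g : Y → Msg Z) (M : Msg X) :
    (M.bind f).bind g = M.bind (fun x => (f x).bind g) := by
  induction M <;> simp_all [bind]

theorem bind_var {X : Type} (M : Msg X) : M.bind var = M := by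
  induction M <;> simp_all [bind]

theorem map_map {X Y Z : Type} (f : X → Y) (g : Y → Z) (M : Msg X) :
    (M.map f).map g = M.map (fun x => g (f x)) := by
  simp [map, bind_bind, bind]

theorem map_id' {X : Type} (M : Msg X) : M.map (fun x => x) = M := bind_var M

theorem map_bind {X Y Z : Type} (f : X → Y) (g : Y → Msg Z) (M : Msg X) :
    (M.map f).bind g = M.bind (fun x => g (f x)) := by
  simp [map, bind_bind, bind]

theorem map_injective {X Y : Type} {f : X → Y} (hf : Function.Injective f) :
    Function.Injective (map f) := by
  intro M
  induction M <;> intro N h <;> cases N <;> simp_all [map, bind] <;>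
    first | exact hf h | grind

theorem bind_congr {X Y : Type} {f g : X → Msg Y} {M : Msg X} (h : ∀ x ∈ M.atoms, f x = g x) :
    M.bind f = M.bind g := by
  induction M <;> simp_all [bind, atoms]

theorem atoms_map {X Y : Type} (f : X → Y) (M : Msg X) : (M.map f).atoms = f '' M.atoms := by
  induction M <;> simp_all [map, bind, atoms, Set.image_union]

theorem finite_atoms {X : Type} (M : Msg X) : M.atoms.Finite := by
  induction M <;> simp_all [atoms]

/-- Normal forms for the rewriting system of pairs and symmetric encryption. -/
def normFst {X : Type} : Msg X → Msg X
  | pair M _ => M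
  | M => fst M

/-- The second projection of a message in normal form. -/
def normSnd {X : Type} : Msg X → Msg X
  | pair _ N => N
  | M => snd M

open Classical in
/-- The decryption of a message in normal form. -/
noncomputable def normDec {X : Type} : Msg X → Msg X → Msg X
  | enc M L, K => if L = K then M else dec (enc M L) K
  | M, K => dec M K

/-- The normal form of a message. -/
noncomputable def norm {X : Type} : Msg X → Msg X
  | var x => var x
  | pair M N => pair (norm M) (norm N)
  | fst M => normFst (norm M)
  | snd M => normSnd (norm M)
  | enc M N => enc (norm M) (norm N)
  | dec M N => normDec (norm M) (norm N)

end Msg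

/-- Every rule of the congruence is respected by normalisation. This one direction suffices: it
refutes equations by computing two different normal forms, while equations that hold are derived
directly from the rules. -/
theorem EqE.norm_eq {X : Type} {M N : Msg X} (h : EqE M N) : M.norm = N.norm := by
  induction h <;> simp_all [Msg.norm, Msg.normFst, Msg.normSnd, Msg.normDec]

theorem EqE.bind {X Y : Type} (f : X → Msg Y) {M N : Msg X} (h : EqE M N) :
    EqE (M.bind f) (N.bind f) := by
  induction h with
  | refl => exact .refl _
  | symm _ ih => exact ih.symm
  | trans _ _ ih ih' => exact ih.trans ih'
  | pair _ _ ih ih' => exact .pair ih ih'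
  | fst _ ih => exact .fst ih
  | snd _ ih => exact .snd ih
  | enc _ _ ih ih' => exact .enc ih ih'
  | dec _ _ ih ih' => exact .dec ih ih'
  | fst_pair => exact .fst_pair _ _
  | snd_pair => exact .snd_pair _ _
  | dec_enc => exact .dec_enc _ _

/-- The congruence is closed under substitution, so a left inverse of the renaming carries an
equation back. -/
theorem eqE_map_iff {X Y : Type} [Nonempty X] {f : X → Y} (hf : Function.Injective f)
    {M N : Msg X} : EqE (M.map f) (N.map f) ↔ EqE M N := by
  refine ⟨fun h => ?_, fun h => h.bind _⟩
  obtain ⟨g, hg⟩ := hf.hasLeftInverse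
  have h' := h.bind (fun y => .var (g y))
  simpa [Msg.map_bind, hg _, Msg.bind_var] using h'

theorem eqE_var_iff {X : Type} {x y : X} : EqE (.var x) (.var y) ↔ x = y := by
  refine ⟨fun h => ?_, fun h => h ▸ .refl _⟩
  simpa [Msg.norm] using h.norm_eq

theorem not_eqE_enc_var {X : Type} (M K : Msg X) (x : X) : ¬ EqE (.enc M K) (.var x) :=
  fun h => by simpa [Msg.norm] using h.norm_eq

theorem not_eqE_snd_dec_var {X : Type} (n x k : X) :
    ¬ EqE (.var n) (.snd (.dec (.var x) (.var k))) :=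
  fun h => by simpa [Msg.norm, Msg.normDec, Msg.normSnd] using h.norm_eq

/-- Under distinct atomic keys the decryption is stuck, so the right-hand side normalises to a
projection and not to an atom. -/
theorem key_eq_of_eqE_snd_dec_enc {X : Type} {n k l : X} {M : Msg X}
    (h : EqE (.var n) (.snd (.dec (.enc M (.var l)) (.var k)))) : l = k := by
  by_contra hne
  simpa [Msg.norm, Msg.normDec, Msg.normSnd, hne] using h.norm_eq

theorem eqE_snd_dec_enc {X : Type} (M N K : Msg X) :
    EqE N (.snd (.dec (.enc (.pair M N) K) K)) :=
  ((EqE.snd (.dec_enc _ _)).trans (.snd_pair _ _)).symm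

end APi

-- Processes as multisets of sequential threads.

namespace APi

/-- The states of the sequential components of the two systems; the flag `b` tells the system
with many sessions for a key from the one with a single session. -/
inductive Thread : Type
  | repl : Bool → Thread
  | fresh : Bool → Thread
  | sessions : ℕ → Thread
  | ver : ℕ → Thread
  /-- A verifier that has received a nonce. -/
  | verOut : ℕ → Msg ℕ → Thread
  /-- A verifier that has finished. -/
  | verDone : ℕ → Thread
  | pro : ℕ → Thread
  /-- A prover that has sent its nonce. -/
  | proIn : ℕ → ℕ → Thread
  /-- A prover that has received a message. -/
  | proOut : ℕ → ℕ → Msg ℕ → Thread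
  /-- A prover that has finished. -/
  | proDone : Thread

namespace Thread

/-- The sessions for the key that is restricted outside. -/
def session (c d e : ℕ) : Bool → Proc
  | true => .bang (.par (verifier (c + 1) (d + 1) 0) (prover (e + 1) (c + 1) (d + 1) 0))
  | false => .par (verifier (c + 1) (d + 1) 0) (prover (e + 1) (c + 1) (d + 1) 0)

/-- The process of a thread, for the channels `c`, `d` and the error message `e`. -/
def toProc (c d e : ℕ) : Thread → Proc
  | repl b => .bang (.nu (session c d e b))
  | fresh b => .nu (session c d e b)
  | sessions k => .bang (.par (verifier c d k) (prover e c d k))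
  | ver k => verifier c d k
  | verOut k N => .nu (.guarded (.out (.var (c + 1))
      (.enc (.pair (.var 0) (N.map Nat.succ)) (.var (k + 1))) .nil))
  | verDone _ => .nil
  | pro k => prover e c d k
  | proIn k n => .guarded (.inp (.var d)
      (.cond (.var (n + 1)) (.snd (.dec (.var 0) (.var (k + 1))))
        (.guarded (.out (.var (c + 1))
          (.enc (.pair (.var (n + 1)) (.fst (.dec (.var 0) (.var (k + 1))))) (.var (k + 1))) .nil))
        (.guarded (.out (.var (c + 1)) (.var (e + 1)) .nil))))
  | proOut k n y => .cond (.var n) (.snd (.dec y (.var k)))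
      (.guarded (.out (.var c) (.enc (.pair (.var n) (.fst (.dec y (.var k)))) (.var k)) .nil))
      (.guarded (.out (.var c) (.var e) .nil))
  | proDone => .nil

/-- A thread under `m` further binders. -/
def shift (m : ℕ) : Thread → Thread
  | repl b => repl b
  | fresh b => fresh b
  | sessions k => sessions (k + m)
  | ver k => ver (k + m)
  | verOut k N => verOut (k + m) (N.map (· + m))
  | verDone k => verDone (k + m)
  | pro k => pro (k + m)
  | proIn k n => proIn (k + m) (n + m)
  | proOut k n y => proOut (k + m) (n + m) (y.map (· + m))
  | proDone => proDone

theorem toProc_shift (c d e m : ℕ) (t : Thread) :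
    (t.toProc c d e).shift m = (t.shift m).toProc (c + m) (d + m) (e + m) := by
  cases t with
  | repl b => cases b <;> rfl
  | fresh b => cases b <;> rfl
  | verOut k N =>
    have h : (N.map Nat.succ).bind (up (fun i => .var (i + m))) =
        (N.map (· + m)).map Nat.succ := by
      simp only [Msg.map_bind, Msg.map_map]
      rfl
    simp only [Proc.shift, Proc.rename, toProc, shift, Proc.subst, Guarded.subst, Msg.bind, h]
    rfl
  | _ => rfl

/-- The threads that a replicated thread unfolds to. -/
def unfold : Thread → Multiset Thread
  | repl b => {fresh b, repl b}
  | sessions k => {ver k, pro k, sessions k}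
  | _ => 0

/-- The threads of a session for a new key. -/
def opened : Bool → Multiset Thread
  | true => {sessions 0}
  | false => {ver 0, pro 0}

/-- All threads under `m` further binders. -/
def shiftAll (m : ℕ) (S : Multiset Thread) : Multiset Thread := S.map (shift m)

/-- `Repr c d e S P`: the parallel components of `P` are the threads `S`. -/
inductive Repr (c d e : ℕ) : Multiset Thread → Proc → Prop
  | thread (t : Thread) {P : Proc} : P = t.toProc c d e → Repr c d e {t} P
  | par {S T : Multiset Thread} {P Q : Proc} : Repr c d e S P → Repr c d e T Q →
      Repr c d e (S + T) (.par P Q)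

theorem Repr.shift {c d e : ℕ} {S : Multiset Thread} {P : Proc} (h : Repr c d e S P) (m : ℕ) :
    Repr (c + m) (d + m) (e + m) (shiftAll m S) (P.shift m) := by
  induction h with
  | thread t h =>
    subst h
    exact .thread _ (toProc_shift c d e m t)
  | par _ _ ih ih' =>
    rw [shiftAll, Multiset.map_add]
    exact .par ih ih'

theorem repr_toProc (c d e : ℕ) (t : Thread) : Repr c d e {t} (t.toProc c d e) := .thread t rfl

theorem repr_unfold_sessions (c d e k : ℕ) : Repr c d e (sessions k).unfold
    (.par (.par (verifier c d k) (prover e c d k))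
      (.bang (.par (verifier c d k) (prover e c d k)))) :=
  .par (.par (repr_toProc c d e (ver k)) (repr_toProc c d e (pro k))) (repr_toProc c d e (sessions k))

theorem repr_unfold_repl (c d e : ℕ) (b : Bool) : Repr c d e (repl b).unfold
    (.par (.nu (session c d e b)) (.bang (.nu (session c d e b)))) :=
  .par (repr_toProc c d e (fresh b)) (repr_toProc c d e (repl b))

theorem repr_opened (c d e : ℕ) (b : Bool) :
    Repr (c + 1) (d + 1) (e + 1) (opened b) (session c d e b) := by
  cases b
  · exact .par (repr_toProc _ _ _ (ver 0)) (repr_toProc _ _ _ (pro 0))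
  · exact repr_toProc _ _ _ (sessions 0)

/-- Transitions of a thread, on the channel `c` for outputs and on `d` for inputs. -/
inductive Act : ℕ → ℕ → ℕ → Thread → APi.Act ℕ → ℕ → Frame → Multiset Thread → Prop
  | ver {c d e : ℕ} (k : ℕ) (N : Msg ℕ) : Act c d e (ver k) (.inp (.var d) N) 0 .idn {verOut k N}
  | verOut {c d e : ℕ} (k : ℕ) (N : Msg ℕ) (l : ℕ) :
      Act c d e (verOut k N) (.out (.var c) (root l)) 1
        (.single (root l) (.enc (.pair (.var 0) (N.map Nat.succ)) (.var (k + 1))))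
        {verDone (k + 1)}
  | pro {c d e : ℕ} (k l : ℕ) :
      Act c d e (pro k) (.out (.var c) (root l)) 1 (.single (root l) (.var 0)) {proIn (k + 1) 0}
  | proIn {c d e : ℕ} (k n : ℕ) (N : Msg ℕ) :
      Act c d e (proIn k n) (.inp (.var d) N) 0 .idn {proOut k n N}
  | proOut_accept {c d e : ℕ} (k n : ℕ) (y : Msg ℕ) (l : ℕ) :
      EqE (.var n) (.snd (.dec y (.var k))) →
      Act c d e (proOut k n y) (.out (.var c) (root l)) 0
        (.single (root l) (.enc (.pair (.var n) (.fst (.dec y (.var k)))) (.var k))) {proDone}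
  | proOut_reject {c d e : ℕ} (k n : ℕ) (y : Msg ℕ) (l : ℕ) :
      ¬ EqE (.var n) (.snd (.dec y (.var k))) →
      Act c d e (proOut k n y) (.out (.var c) (root l)) 0 (.single (root l) (.var e)) {proDone}
  | unfold {c d e : ℕ} {t s : Thread} {S T : Multiset Thread} {π : APi.Act ℕ} {m : ℕ} {σ : Frame} :
      t.unfold = s ::ₘ S → Act c d e s π m σ T → Act c d e t π m σ (T + shiftAll m S)
  | fresh {c d e : ℕ} {b : Bool} {s : Thread} {S T : Multiset Thread} {π : APi.Act ℕ} {m : ℕ}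
      {σ : Frame} :
      opened b = s ::ₘ S → Act (c + 1) (d + 1) (e + 1) s (π.map Nat.succ) m σ T →
      Act c d e (fresh b) π (m + 1) σ (T + shiftAll m S)

/-- Transitions of a multiset of threads. -/
def ActIn (c d e : ℕ) (S : Multiset Thread) (π : APi.Act ℕ) (m : ℕ) (σ : Frame)
    (S' : Multiset Thread) : Prop :=
  ∃ t R T, S = t ::ₘ R ∧ Act c d e t π m σ T ∧ S' = T + shiftAll m R

theorem ActIn.add {c d e : ℕ} {S S' : Multiset Thread} {π : APi.Act ℕ} {m : ℕ} {σ : Frame}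
    (h : ActIn c d e S π m σ S') (R : Multiset Thread) :
    ActIn c d e (S + R) π m σ (S' + shiftAll m R) := by
  obtain ⟨t, U, T, rfl, h, rfl⟩ := h
  exact ⟨t, U + R, T, by simp, h, by simp [shiftAll, add_assoc]⟩

theorem Act.actIn {c d e : ℕ} {t : Thread} {T : Multiset Thread} {π : APi.Act ℕ} {m : ℕ}
    {σ : Frame} (h : Act c d e t π m σ T) : ActIn c d e {t} π m σ T :=
  ⟨t, 0, T, rfl, h, by simp [shiftAll]⟩

/-- A move of one component lifts through the surrounding parallel compositions; its siblings are
only placed under the `m` new restrictions. The multiset is tied to `t ::ₘ R` by an equation so that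
the induction can split it. -/
theorem Repr.step {c d e : ℕ} {t : Thread} {S T R : Multiset Thread} {P : Proc}
    {π : APi.Act ℕ} {m : ℕ} {σ : Frame} (h : Repr c d e S P) (hS : S = t ::ₘ R)
    (hstep : ∃ l Q, Step (t.toProc c d e) π (.one l) ⟨m, σ, Q⟩ ∧
      Repr (c + m) (d + m) (e + m) T Q) :
    ∃ l Q, Step P π (.one l) ⟨m, σ, Q⟩ ∧
      Repr (c + m) (d + m) (e + m) (T + shiftAll m R) Q := by
  induction h generalizing R with
  | thread s hs =>
    obtain ⟨rfl, rfl⟩ : s = t ∧ R = 0 := by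
      have := (Multiset.singleton_eq_cons_iff (a := s) (b := t) R).1 hS
      tauto
    subst hs
    simpa [shiftAll] using hstep
  | @par S₁ S₂ P Q h₁ h₂ ih₁ ih₂ =>
    have ht : t ∈ S₁ + S₂ := hS ▸ Multiset.mem_cons_self t R
    rcases Multiset.mem_add.1 ht with ht | ht
    · obtain ⟨U, rfl⟩ := Multiset.exists_cons_of_mem ht
      obtain ⟨l, Q', hQ', hr⟩ := ih₁ rfl
      obtain rfl : U + S₂ = R := by simpa using hS
      refine ⟨_, _, .parL hQ', ?_⟩
      rw [shiftAll, Multiset.map_add, ← add_assoc]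
      exact .par hr (h₂.shift m)
    · obtain ⟨U, rfl⟩ := Multiset.exists_cons_of_mem ht
      obtain ⟨l, Q', hQ', hr⟩ := ih₂ rfl
      obtain rfl : S₁ + U = R := by simpa using hS
      refine ⟨_, _, .parR hQ', ?_⟩
      rw [shiftAll, Multiset.map_add, add_left_comm]
      exact .par (h₁.shift m) hr

theorem unfold_eq_cons {t s : Thread} {S : Multiset Thread} (h : t.unfold = s ::ₘ S) :
    (∃ k, t = sessions k) ∨ ∃ b, t = repl b := by
  cases t <;> simp [unfold] at h ⊢

theorem Act.step {c d e : ℕ} {t : Thread} {T : Multiset Thread} {π : APi.Act ℕ} {m : ℕ}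
    {σ : Frame} (h : Act c d e t π m σ T) :
    ∃ l Q, Step (t.toProc c d e) π (.one l) ⟨m, σ, Q⟩ ∧ Repr (c + m) (d + m) (e + m) T Q := by
  induction h with
  | ver k N => exact ⟨_, _, .guarded (.inp N (.refl _)), .thread _ rfl⟩
  | verOut k N l =>
    exact ⟨_, _, .ext (A := ⟨0, _, _⟩) (.guarded (.out l (.refl _))), .thread _ rfl⟩
  | pro k l => exact ⟨_, _, .ext (A := ⟨0, _, _⟩) (.guarded (.out l (.refl _))), .thread _ rfl⟩
  | proIn k n N => exact ⟨_, _, .guarded (.inp N (.refl _)), .thread _ rfl⟩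
  | proOut_accept k n y l h =>
    exact ⟨_, _, .condThen h (.guarded (.out l (.refl _))), .thread _ rfl⟩
  | proOut_reject k n y l h =>
    exact ⟨_, _, .condElse h (.guarded (.out l (.refl _))), .thread _ rfl⟩
  | unfold hs _ ih =>
    rcases unfold_eq_cons hs with ⟨k, rfl⟩ | ⟨b, rfl⟩
    · obtain ⟨l, Q, hQ, hr⟩ := (repr_unfold_sessions _ _ _ k).step hs ih
      exact ⟨l, Q, .bang hQ, hr⟩
    · obtain ⟨l, Q, hQ, hr⟩ := (repr_unfold_repl _ _ _ b).step hs ih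
      exact ⟨l, Q, .bang hQ, hr⟩
  | @fresh c d e b s S T π m σ hs _ ih =>
    obtain ⟨l, Q, hQ, hr⟩ := (repr_opened c d e b).step hs ih
    refine ⟨l, Q, .ext (A := ⟨m, σ, Q⟩) hQ, ?_⟩
    have hm (x : ℕ) : x + (m + 1) = x + 1 + m := by omega
    simpa only [hm] using hr

theorem ActIn.step {c d e : ℕ} {S S' : Multiset Thread} {π : APi.Act ℕ} {m : ℕ} {σ : Frame}
    {P : Proc} (h : ActIn c d e S π m σ S') (hP : Repr c d e S P) :
    ∃ l Q, Step P π (.one l) ⟨m, σ, Q⟩ ∧ Repr (c + m) (d + m) (e + m) S' Q := by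
  obtain ⟨t, R, T, rfl, h, rfl⟩ := h
  exact hP.step rfl h.step

/-- Inputs on `d` and outputs on `c`. -/
def OnChannels (c d : ℕ) : APi.Act ℕ → Prop
  | .inp M _ => M = .var d
  | .out M _ => M = .var c
  | .tau => False

theorem OnChannels.map_succ {c d : ℕ} {π : APi.Act ℕ} (h : OnChannels c d π) :
    OnChannels (c + 1) (d + 1) (π.map Nat.succ) := by
  cases π <;> simp_all [OnChannels, APi.Act.map, APi.Act.bind, Msg.bind]

theorem step_inp {c d : ℕ} {P : Proc} {π : APi.Act ℕ} {u : LocLabel} {A : Ext}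
    (h : Step (.guarded (.inp (.var d) P)) π u A) (hπ : OnChannels c d π) :
    ∃ N, π = .inp (.var d) N ∧ A = ⟨0, .idn, P.inst N⟩ := by
  cases h with
  | guarded h =>
    cases h
    exact ⟨_, congrArg₂ _ hπ rfl, rfl⟩

theorem step_out {c d : ℕ} {N : Msg ℕ} {P : Proc} {π : APi.Act ℕ} {u : LocLabel} {A : Ext}
    (h : Step (.guarded (.out (.var c) N P)) π u A) (hπ : OnChannels c d π) :
    ∃ l, π = .out (.var c) (root l) ∧ A = ⟨0, .single (root l) N, P⟩ := by
  cases h with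
  | guarded h =>
    cases h
    exact ⟨_, congrArg₂ _ hπ rfl, rfl⟩

theorem step_nu_out {c d : ℕ} {N : Msg ℕ} {P : Proc} {π : APi.Act ℕ} {u : LocLabel} {A : Ext}
    (h : Step (.nu (.guarded (.out (.var (c + 1)) N P))) π u A) (hπ : OnChannels c d π) :
    ∃ l, π = .out (.var c) (root l) ∧ A = ⟨1, .single (root l) N, P⟩ := by
  cases h with
  | ext h =>
    obtain ⟨l, hl, rfl⟩ := step_out h hπ.map_succ
    refine ⟨l, ?_, rfl⟩
    cases π with
    | out M a =>
      have ha : a = root l := by simpa [APi.Act.map, APi.Act.bind] using (APi.Act.out.inj hl).2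
      rw [show M = .var c from hπ, ha]
    | _ => cases hl

/-- The inversion of transitions for the representation of processes by threads. -/
theorem Repr.actIn {c d e : ℕ} {S : Multiset Thread} {P : Proc} {π : APi.Act ℕ} {u : LocLabel}
    {A : Ext} (hP : Repr c d e S P) (h : Step P π u A) (hπ : OnChannels c d π) :
    ∃ S', ActIn c d e S π A.bound A.frame S' ∧
      Repr (c + A.bound) (d + A.bound) (e + A.bound) S' A.proc := by
  -- The induction follows the transition and not the representation, because a replicated process
  -- acts through its unfolding, which is no smaller. Interactions are excluded by `OnChannels`; the
  -- attack formula never looks at them.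
  induction h generalizing c d e S with
  | guarded h =>
    cases hP with
    | thread t ht =>
      cases t <;> simp only [toProc, verifier, prover, reduceCtorEq, Proc.guarded.injEq] at ht
      · subst ht
        obtain ⟨N, rfl, rfl⟩ := step_inp (.guarded h) hπ
        exact ⟨_, (Act.ver _ N).actIn, .thread _ rfl⟩
      · subst ht
        obtain ⟨N, rfl, rfl⟩ := step_inp (.guarded h) hπ
        exact ⟨_, (Act.proIn _ _ N).actIn, .thread _ rfl⟩
  | parL _ ih =>
    cases hP with
    | thread t ht => cases t <;> simp [toProc, verifier, prover] at ht
    | par h₁ h₂ =>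
      obtain ⟨S', hS, hr⟩ := ih h₁ hπ
      exact ⟨_, hS.add _, .par hr (h₂.shift _)⟩
  | parR _ ih =>
    cases hP with
    | thread t ht => cases t <;> simp [toProc, verifier, prover] at ht
    | par h₁ h₂ =>
      obtain ⟨S', hS, hr⟩ := ih h₂ hπ
      refine ⟨_, ?_, .par (h₁.shift _) hr⟩
      rw [add_comm, add_comm (shiftAll _ _)]
      exact hS.add _
  | @ext P π u A h ih =>
    cases hP with
    | thread t ht =>
      have h' := h.ext
      cases t <;> simp only [toProc, verifier, prover, reduceCtorEq, Proc.nu.injEq] at ht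
      · subst ht
        obtain ⟨S', ⟨t, R, T, hR, hT, rfl⟩, hr⟩ := ih (repr_opened _ _ _ _) hπ.map_succ
        refine ⟨_, (Act.fresh hR hT).actIn, ?_⟩
        have hm (x : ℕ) : x + A.nu.bound = x + 1 + A.bound := by
          simp only [Ext.nu]
          omega
        simp only [hm]
        exact hr
      · subst ht
        obtain ⟨l, rfl, hA⟩ := step_nu_out h' hπ
        rw [hA]
        exact ⟨_, (Act.verOut _ _ l).actIn, .thread _ rfl⟩
      · subst ht
        obtain ⟨l, rfl, hA⟩ := step_nu_out h' hπ
        rw [hA]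
        exact ⟨_, (Act.pro _ l).actIn, .thread _ rfl⟩
  | mat =>
    cases hP with
    | thread t ht => cases t <;> simp [toProc, verifier, prover] at ht
  | condThen hE h =>
    cases hP with
    | thread t ht =>
      cases t <;> simp only [toProc, verifier, prover, reduceCtorEq, Proc.cond.injEq] at ht
      obtain ⟨rfl, rfl, rfl, rfl⟩ := ht
      obtain ⟨l, rfl, rfl⟩ := step_out h hπ
      exact ⟨_, (Act.proOut_accept _ _ _ l hE).actIn, .thread _ rfl⟩
  | condElse hE h =>
    cases hP with
    | thread t ht =>
      cases t <;> simp only [toProc, verifier, prover, reduceCtorEq, Proc.cond.injEq] at ht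
      obtain ⟨rfl, rfl, rfl, rfl⟩ := ht
      obtain ⟨l, rfl, rfl⟩ := step_out h hπ
      exact ⟨_, (Act.proOut_reject _ _ _ l hE).actIn, .thread _ rfl⟩
  | bang _ ih =>
    cases hP with
    | thread t ht =>
      cases t <;> simp only [toProc, verifier, prover, reduceCtorEq, Proc.bang.injEq] at ht
      · subst ht
        obtain ⟨S', ⟨t, R, T, hR, hT, rfl⟩, hr⟩ := ih (repr_unfold_repl _ _ _ _) hπ
        exact ⟨_, (Act.unfold hR hT).actIn, hr⟩
      · subst ht
        obtain ⟨S', ⟨t, R, T, hR, hT, rfl⟩, hr⟩ := ih (repr_unfold_sessions _ _ _ _) hπ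
        exact ⟨_, (Act.unfold hR hT).actIn, hr⟩
  | closeL => exact hπ.elim
  | closeR => exact hπ.elim

end Thread
end APi

-- Counting error messages, acceptances and verifiers.

namespace APi
namespace Thread

/-- The sum of a weight over all threads. -/
def total (w : Thread → ℕ) (S : Multiset Thread) : ℕ := (S.map w).sum

@[simp] theorem total_add (w : Thread → ℕ) (S T : Multiset Thread) :
    total w (S + T) = total w S + total w T := by
  simp [total]

@[simp] theorem total_cons (w : Thread → ℕ) (t : Thread) (S : Multiset Thread) :
    total w (t ::ₘ S) = w t + total w S := by
  simp [total]

@[simp] theorem total_singleton (w : Thread → ℕ) (t : Thread) : total w {t} = w t := by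
  simp [total]

theorem total_shiftAll {w w' : Thread → ℕ} {m : ℕ} (h : ∀ t, w (shift m t) = w' t)
    (S : Multiset Thread) : total w (shiftAll m S) = total w' S := by
  simp [total, shiftAll, h]

theorem le_total {w : Thread → ℕ} {t : Thread} {S : Multiset Thread} (h : t ∈ S) :
    w t ≤ total w S := by
  obtain ⟨R, rfl⟩ := Multiset.exists_cons_of_mem h
  simp

theorem add_le_total {w : Thread → ℕ} {s t : Thread} {S : Multiset Thread} (hs : s ∈ S)
    (ht : t ∈ S) (hne : s ≠ t) : w s + w t ≤ total w S := by
  obtain ⟨R, rfl⟩ := Multiset.exists_cons_of_mem hs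
  have := le_total (w := w) ((Multiset.mem_cons.1 ht).resolve_left hne.symm)
  simpa using this

theorem exists_pos_of_total_pos {w : Thread → ℕ} {S : Multiset Thread} (h : total w S ≠ 0) :
    ∃ t ∈ S, w t ≠ 0 := by
  by_contra! hw
  exact h (Multiset.sum_eq_zero (by simpa using hw))

open Classical in
/-- The number of error messages that a thread may send on bad inputs. -/
noncomputable def errors : Thread → ℕ
  | proIn _ _ => 1
  | proOut k n y => if EqE (.var n) (.snd (.dec y (.var k))) then 0 else 1
  | _ => 0

open Classical in
/-- The number of answers that a thread has accepted and not yet replied to. -/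
noncomputable def accepts : Thread → ℕ
  | proOut k n y => if EqE (.var n) (.snd (.dec y (.var k))) then 1 else 0
  | _ => 0

/-- The number of verifiers with a given key. -/
def verifiers (κ : ℕ) : Thread → ℕ
  | ver k => if k = κ then 1 else 0
  | verOut k _ => if k = κ then 1 else 0
  | verDone k => if k = κ then 1 else 0
  | _ => 0

theorem accept_shift_iff {k n m : ℕ} {y : Msg ℕ} :
    EqE (.var (n + m)) (.snd (.dec (y.map (· + m)) (.var (k + m)))) ↔
      EqE (.var n) (.snd (.dec y (.var k))) :=
  eqE_map_iff (f := (· + m)) (M := .var n) (N := .snd (.dec y (.var k)))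
    (add_left_injective m)

open Classical in
theorem errors_shift (m : ℕ) (t : Thread) : errors (shift m t) = errors t := by
  cases t with
  | proOut => exact if_congr accept_shift_iff rfl rfl
  | _ => rfl

open Classical in
theorem accepts_shift (m : ℕ) (t : Thread) : accepts (shift m t) = accepts t := by
  cases t with
  | proOut => exact if_congr accept_shift_iff rfl rfl
  | _ => rfl

@[simp] theorem total_errors_shiftAll (m : ℕ) (S : Multiset Thread) :
    total errors (shiftAll m S) = total errors S := total_shiftAll (errors_shift m) S

@[simp] theorem total_accepts_shiftAll (m : ℕ) (S : Multiset Thread) :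
    total accepts (shiftAll m S) = total accepts S := total_shiftAll (accepts_shift m) S

/-- The indices below `m` are the newly restricted names, which no thread from outside can hold as
its key. -/
theorem total_verifiers_shiftAll (κ m : ℕ) (S : Multiset Thread) :
    total (verifiers κ) (shiftAll m S) = if κ < m then 0 else total (verifiers (κ - m)) S := by
  split_ifs with h
  · rw [total_shiftAll (w' := fun _ => 0)]
    · simp [total]
    · intro t
      cases t <;> simp [verifiers, shift] <;> omega
  · refine total_shiftAll (fun t => ?_) S
    cases t <;> simp only [verifiers, shift] <;> congr 1 <;> simp only [eq_iff_iff] <;> omega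

/-- A thread that has not been active. -/
def IsIdle : Thread → Prop
  | repl _ => True
  | fresh _ => True
  | sessions _ => True
  | ver _ => True
  | pro _ => True
  | _ => False

theorem IsIdle.errors_eq {t : Thread} (h : t.IsIdle) : errors t = 0 := by
  cases t <;> simp_all [IsIdle, errors]

theorem IsIdle.accepts_eq {t : Thread} (h : t.IsIdle) : accepts t = 0 := by
  cases t <;> simp_all [IsIdle, accepts]

theorem total_errors_eq_zero {S : Multiset Thread} (h : ∀ t ∈ S, t.IsIdle) :
    total errors S = 0 := by
  by_contra h'
  obtain ⟨t, ht, hne⟩ := exists_pos_of_total_pos h'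
  exact hne (h t ht).errors_eq

theorem total_accepts_eq_zero {S : Multiset Thread} (h : ∀ t ∈ S, t.IsIdle) :
    total accepts S = 0 := by
  by_contra h'
  obtain ⟨t, ht, hne⟩ := exists_pos_of_total_pos h'
  exact hne (h t ht).accepts_eq

/-- Unfolding involves idle threads only. They have weight zero, so the copies left behind by an
unfolding never disturb the counts. -/
theorem isIdle_of_unfold {t s : Thread} {S : Multiset Thread} (h : t.unfold = s ::ₘ S) :
    t.IsIdle ∧ s.IsIdle ∧ ∀ r ∈ S, r.IsIdle := by
  have h' : t.IsIdle ∧ ∀ r ∈ t.unfold, r.IsIdle := by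
    cases t <;> simp [unfold, IsIdle] at h ⊢
  rw [h] at h'
  simpa using h'

theorem isIdle_of_opened {b : Bool} {s : Thread} {S : Multiset Thread} (h : opened b = s ::ₘ S) :
    s.IsIdle ∧ ∀ r ∈ S, r.IsIdle := by
  have h' : ∀ r ∈ opened b, r.IsIdle := by cases b <;> simp [opened, IsIdle]
  rw [h] at h'
  simpa using h'

/-- A waiting prover that reads a message it will reject keeps weight one in `errors`. Acceptance is
the only way in which an input can change the counts. -/
theorem Act.of_inp {c d e : ℕ} {t : Thread} {M N : Msg ℕ} {m : ℕ} {σ : Frame}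
    {T : Multiset Thread} (h : Act c d e t (.inp M N) m σ T) :
    (total errors T = errors t ∧ total accepts T = accepts t) ∨
      ∃ k n, t = Thread.proIn k n ∧ EqE (.var n) (.snd (.dec N (.var k))) := by
  generalize hπ : APi.Act.inp M N = π at h
  induction h generalizing M N with
  | proIn k n N' =>
    obtain ⟨_, rfl⟩ := APi.Act.inp.inj hπ
    by_cases hE : EqE (.var n) (.snd (.dec N (.var k)))
    · exact .inr ⟨k, n, rfl, hE⟩
    · simp [errors, accepts, hE]
  | unfold hs _ ih =>
    obtain ⟨ht, hs, hS⟩ := isIdle_of_unfold hs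
    rcases ih hπ with h | ⟨k, n, rfl, _⟩
    · simp [h, ht.errors_eq, hs.errors_eq, ht.accepts_eq, hs.accepts_eq, total_errors_eq_zero hS,
        total_accepts_eq_zero hS]
    · exact hs.elim
  | fresh hs _ ih =>
    obtain ⟨hs, hS⟩ := isIdle_of_opened hs
    subst hπ
    rcases ih rfl with h | ⟨k, n, rfl, _⟩
    · refine .inl ⟨?_, ?_⟩
      · simp [h, hs.errors_eq, total_errors_eq_zero hS,
          IsIdle.errors_eq (t := .fresh _) trivial]
      · simp [h, hs.accepts_eq, total_accepts_eq_zero hS,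
          IsIdle.accepts_eq (t := .fresh _) trivial]
    · exact hs.elim
  | _ => first | cases hπ; done | simp [errors, accepts]

/-- The four alternatives are a verifier's answer, an accepting reply, an error and a fresh nonce.
The bound `0 < m` in the last one is what later separates the nonce, at index `0`, from the error
variable, at index `e + m`. -/
theorem Act.of_out {c d e : ℕ} {t : Thread} {M : Msg ℕ} {a : Alias} {m : ℕ} {σ : Frame}
    {T : Multiset Thread} (h : Act c d e t (.out M a) m σ T) :
    ∃ v, σ = .single a v ∧
      ((∃ k N, t = Thread.verOut k N ∧ m = 1 ∧
          v = .enc (.pair (.var 0) (N.map Nat.succ)) (.var (k + 1)) ∧ T = {verDone (k + 1)}) ∨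
        (∃ N K, v = .enc N K ∧ errors t = 0 ∧ accepts t = 1 ∧ total errors T = 0 ∧
          total accepts T = 0) ∨
        (v = .var (e + m) ∧ errors t = 1 ∧ accepts t = 0 ∧ total errors T = 0 ∧
          total accepts T = 0) ∨
        (v = .var 0 ∧ 0 < m ∧ t.IsIdle ∧ total errors T = 1 ∧ total accepts T = 0)) := by
  generalize hπ : APi.Act.out M a = π at h
  induction h generalizing M a with
  | verOut k N =>
    cases hπ
    exact ⟨_, rfl, .inl ⟨k, N, rfl, rfl, rfl, rfl⟩⟩
  | pro =>
    cases hπ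
    exact ⟨_, rfl, .inr (.inr (.inr ⟨rfl, one_pos, trivial, by simp [errors, accepts]⟩))⟩
  | proOut_accept k n y l h =>
    cases hπ
    exact ⟨_, rfl, .inr (.inl ⟨_, _, rfl, by simp [errors, accepts, h]⟩)⟩
  | proOut_reject k n y l h =>
    cases hπ
    exact ⟨_, rfl, .inr (.inr (.inl ⟨rfl, by simp [errors, accepts, h]⟩))⟩
  | unfold hs _ ih =>
    obtain ⟨ht, hs, hS⟩ := isIdle_of_unfold hs
    obtain ⟨v, hv, ⟨k, N, rfl, _⟩ | h | h | h⟩ := ih hπ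
    · exact hs.elim
    · obtain ⟨N, K, _, _, h, _⟩ := h
      simp [hs.accepts_eq] at h
    · simp [hs.errors_eq] at h
    · refine ⟨v, hv, .inr (.inr (.inr ⟨h.1, h.2.1, ht, ?_⟩))⟩
      simp [h.2.2.2, total_errors_eq_zero hS, total_accepts_eq_zero hS]
  | fresh hs _ ih =>
    obtain ⟨hs, hS⟩ := isIdle_of_opened hs
    subst hπ
    obtain ⟨v, hv, ⟨k, N, rfl, _⟩ | h | h | h⟩ := ih rfl
    · exact hs.elim
    · obtain ⟨N, K, _, _, h, _⟩ := h
      simp [hs.accepts_eq] at h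
    · simp [hs.errors_eq] at h
    · refine ⟨v, hv, .inr (.inr (.inr ⟨h.1, by omega, trivial, ?_⟩))⟩
      simp [h.2.2.2, total_errors_eq_zero hS, total_accepts_eq_zero hS]
  | _ => cases hπ

theorem ActIn.of_inp {c d e : ℕ} {S S' : Multiset Thread} {M N : Msg ℕ} {m : ℕ} {σ : Frame}
    (h : ActIn c d e S (.inp M N) m σ S') :
    (total errors S' = total errors S ∧ total accepts S' = total accepts S) ∨
      ∃ k n, proIn k n ∈ S ∧ EqE (.var n) (.snd (.dec N (.var k))) := by
  obtain ⟨t, R, T, rfl, h, rfl⟩ := h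
  rcases h.of_inp with h | ⟨k, n, rfl, hE⟩
  · simp [h]
  · exact .inr ⟨k, n, by simp, hE⟩

theorem ActIn.of_out {c d e : ℕ} {S S' : Multiset Thread} {M : Msg ℕ} {a : Alias} {m : ℕ}
    {σ : Frame} (h : ActIn c d e S (.out M a) m σ S') :
    ∃ v, σ = .single a v ∧
      ((∃ k N R, S = verOut k N ::ₘ R ∧ m = 1 ∧
          v = .enc (.pair (.var 0) (N.map Nat.succ)) (.var (k + 1)) ∧
          S' = verDone (k + 1) ::ₘ shiftAll 1 R) ∨
        (∃ N K, v = .enc N K ∧ total errors S' = total errors S ∧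
          total accepts S = total accepts S' + 1) ∨
        (v = .var (e + m) ∧ total errors S = total errors S' + 1 ∧
          total accepts S' = total accepts S) ∨
        (v = .var 0 ∧ 0 < m ∧ total errors S' = total errors S + 1 ∧
          total accepts S' = total accepts S)) := by
  obtain ⟨t, R, T, rfl, h, rfl⟩ := h
  obtain ⟨v, hv, ⟨k, N, rfl, rfl, rfl, rfl⟩ | ⟨N, K, rfl, h⟩ | ⟨rfl, h⟩ | ⟨rfl, hm, ht, h⟩⟩ := h.of_out
  · exact ⟨_, hv, .inl ⟨k, N, R, rfl, rfl, rfl, by simp⟩⟩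
  · exact ⟨_, hv, .inr (.inl ⟨N, K, rfl, by simp [h, add_comm]⟩)⟩
  · exact ⟨_, hv, .inr (.inr (.inl ⟨rfl, by simp [h, add_comm]⟩))⟩
  · exact ⟨_, hv, .inr (.inr (.inr ⟨rfl, hm,
      by simp [h, ht.errors_eq, ht.accepts_eq, add_comm]⟩))⟩

theorem Act.repl_mem {c d e : ℕ} {b : Bool} {t : Thread} {π : APi.Act ℕ} {m : ℕ} {σ : Frame}
    {T : Multiset Thread} (h : Act c d e t π m σ T) (ht : repl b = t) : repl b ∈ T := by
  induction h with
  | @unfold _ _ _ t s S T π m σ hs _ ih =>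
    subst ht
    have hmem : repl b ∈ s ::ₘ S := hs ▸ by simp [Thread.unfold]
    rcases Multiset.mem_cons.1 hmem with h | h
    · exact Multiset.mem_add.2 (.inl (ih h))
    · exact Multiset.mem_add.2 (.inr (Multiset.mem_map.2 ⟨_, h, rfl⟩))
  | _ => cases ht

theorem ActIn.repl_mem {c d e : ℕ} {b : Bool} {S S' : Multiset Thread} {π : APi.Act ℕ} {m : ℕ}
    {σ : Frame} (h : ActIn c d e S π m σ S') (hS : repl b ∈ S) : repl b ∈ S' := by
  obtain ⟨t, R, T, rfl, h, rfl⟩ := h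
  rcases Multiset.mem_cons.1 hS with rfl | hS
  · exact Multiset.mem_add.2 (.inl (h.repl_mem rfl))
  · exact Multiset.mem_add.2 (.inr (Multiset.mem_map.2 ⟨_, hS, rfl⟩))

/-- A thread of the system with a single session for a key. -/
def IsSingle : Thread → Prop
  | repl b => b = false
  | fresh b => b = false
  | sessions _ => False
  | _ => True

theorem IsSingle.shift {t : Thread} (h : t.IsSingle) (m : ℕ) : (t.shift m).IsSingle := by
  cases t <;> exact h

theorem isSingle_of_unfold {t s : Thread} {S : Multiset Thread} (h : t.unfold = s ::ₘ S)
    (ht : t.IsSingle) : ∀ r ∈ s ::ₘ S, r.IsSingle := by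
  rw [← h]
  cases t <;> simp_all [unfold, IsSingle]

/-- A new key brings at most one verifier, from opening a single session. For an older key, shifted
by `m`, a verifier can only turn into a later state of itself. -/
theorem Act.isSingle {c d e : ℕ} {t : Thread} {π : APi.Act ℕ} {m : ℕ} {σ : Frame}
    {T : Multiset Thread} (h : Act c d e t π m σ T) (ht : t.IsSingle) :
    (∀ s ∈ T, s.IsSingle) ∧
      ∀ κ, total (verifiers κ) T ≤ if κ < m then 1 else verifiers (κ - m) t := by
  induction h with
  | @unfold _ _ _ t s S T π m σ hs _ ih =>
    have hall := isSingle_of_unfold hs ht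
    have hv : ∀ κ, total (verifiers κ) (s ::ₘ S) = 0 := by
      rw [← hs]
      cases t <;> simp_all [Thread.unfold, IsSingle, verifiers]
    obtain ⟨h₁, h₂⟩ := ih (hall s (by simp))
    refine ⟨fun r hr => ?_, fun κ => ?_⟩
    · rcases Multiset.mem_add.1 hr with hr | hr
      · exact h₁ r hr
      · obtain ⟨r, hmem, rfl⟩ := Multiset.mem_map.1 hr
        exact (hall r (Multiset.mem_cons_of_mem hmem)).shift m
    · have := h₂ κ
      have := hv (κ - m)
      simp only [total_cons] at this
      rw [total_add, total_verifiers_shiftAll]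
      split_ifs at * <;> omega
  | @fresh _ _ _ b s S T π m σ hs _ ih =>
    obtain rfl : b = false := ht
    have hall : ∀ r ∈ s ::ₘ S, r.IsSingle := by
      rw [← hs]
      simp [opened, IsSingle]
    have hv : ∀ κ, total (verifiers κ) (s ::ₘ S) = if κ = 0 then 1 else 0 := by
      rw [← hs]
      simp [opened, verifiers, eq_comm]
    obtain ⟨h₁, h₂⟩ := ih (hall s (by simp))
    refine ⟨fun r hr => ?_, fun κ => ?_⟩
    · rcases Multiset.mem_add.1 hr with hr | hr
      · exact h₁ r hr
      · obtain ⟨r, hmem, rfl⟩ := Multiset.mem_map.1 hr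
        exact (hall r (Multiset.mem_cons_of_mem hmem)).shift m
    · have := h₂ κ
      have := hv (κ - m)
      simp only [total_cons] at this
      rw [total_add, total_verifiers_shiftAll]
      split_ifs at * <;> omega
  | verOut =>
    refine ⟨by simp [IsSingle], fun κ => ?_⟩
    simp only [total_singleton, verifiers]
    split_ifs <;> omega
  | _ => simp [IsSingle, verifiers]

/-- The threads of the system with a single session for a key, at most one verifier for each. -/
def AreSingle (S : Multiset Thread) : Prop :=
  (∀ t ∈ S, t.IsSingle) ∧ ∀ κ, total (verifiers κ) S ≤ 1

theorem ActIn.areSingle {c d e : ℕ} {S S' : Multiset Thread} {π : APi.Act ℕ} {m : ℕ}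
    {σ : Frame} (h : ActIn c d e S π m σ S') (hS : AreSingle S) : AreSingle S' := by
  obtain ⟨t, R, T, rfl, h, rfl⟩ := h
  obtain ⟨h₁, h₂⟩ := h.isSingle (hS.1 t (by simp))
  refine ⟨fun r hr => ?_, fun κ => ?_⟩
  · rcases Multiset.mem_add.1 hr with hr | hr
    · exact h₁ r hr
    · obtain ⟨r, hmem, rfl⟩ := Multiset.mem_map.1 hr
      exact (hS.1 r (Multiset.mem_cons_of_mem hmem)).shift m
  · have := h₂ κ
    have := hS.2 (κ - m)
    rw [total_cons] at this
    rw [total_add, total_verifiers_shiftAll]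
    split_ifs at * <;> omega

end Thread
end APi

-- Modalities and the formula `noError` in terms of threads.

namespace APi

theorem Msg.emb_injective : Function.Injective Msg.emb := map_injective Sum.inl_injective

theorem eqE_emb_iff {M N : Msg ℕ} : EqE M.emb N.emb ↔ EqE M N := eqE_map_iff Sum.inl_injective

namespace Frame

theorem val_of_eq_some {σ : Frame} {a : Alias} {N : Msg ℕ} (h : σ.toFun a = some N) :
    σ.val a = N.emb := by
  simp [val, h]

theorem update_self (σ : Frame) (a : Alias) (N : Msg ℕ) : (σ.update a N).toFun a = some N := by
  simp [update]

theorem shift_eq_some {σ : Frame} {a : Alias} {N : Msg ℕ} (h : σ.toFun a = some N) (m : ℕ) :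
    (σ.shift m).toFun a = some (N.map (· + m)) := by
  simp [shift, h]

theorem update_shift_eq_some {σ : Frame} {a b : Alias} {M N : Msg ℕ} {m : ℕ}
    (h : σ.toFun a = some N) (hb : b ∉ σ.dom) :
    ((σ.shift m).update b M).toFun a = some (N.map (· + m)) := by
  have hne : a ≠ b := by
    rintro rfl
    exact hb (by simp [dom, h])
  simp [update, shift, Function.update_of_ne hne, h]

theorem single_injective {a b : Alias} {M N : Msg ℕ} (h : single a M = single b N) :
    a = b ∧ M = N := by
  have h' := congrArg (fun σ => σ.toFun a) h
  by_cases hab : a = b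
  · subst hab
    simp only [single, update_self, Option.some.injEq] at h'
    exact ⟨rfl, h'⟩
  · simp only [single, update_self] at h'
    simp [update, idn, Function.update_of_ne hab] at h'

theorem single_ne_idn (a : Alias) (M : Msg ℕ) : single a M ≠ idn := by
  intro h
  have h' := congrArg (fun σ => σ.toFun a) h
  simp only [single, update_self] at h'
  simp [idn] at h'

end Frame

/-- The prefix of an output alias is the location of the output, known only once the transition has
been built. The alias variable is therefore chosen to be fresh under every prefix. -/
theorem exists_root_not_mem {F : Set Alias} (hF : F.Finite) :
    ∃ l, ∀ s, (⟨s, l⟩ : Alias) ∉ F := by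
  obtain ⟨l, hl⟩ := (hF.image Alias.name).exists_notMem
  exact ⟨l, fun s hs => hl ⟨_, hs, rfl⟩⟩

theorem Form.finite_fal (φ : Form) : φ.fal.Finite := by
  have hfal (M : Recipe) : M.fal.Finite := M.finite_atoms.preimage Sum.inr_injective.injOn
  induction φ <;> simp_all [fal]

open Thread

variable {c d e n : ℕ} {S : Multiset Thread} {P : Proc} {σ : Frame}

theorem sat_diaInp {U : Recipe} {N : Msg ℕ} {φ : Form} (hP : Repr (c + n) (d + n) (e + n) S P)
    (hU : (U.lift n).app σ = N.emb) (h : Sat ⟨n, σ, P⟩ (.diaInp (v d) U φ)) :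
    ∃ m S' Q, ActIn (c + n) (d + n) (e + n) S (.inp (.var (d + n)) N) m .idn S' ∧
      Repr (c + (n + m)) (d + (n + m)) (e + (n + m)) S' Q ∧ Sat ⟨n + m, σ.shift m, Q⟩ φ := by
  rw [Sat] at h
  obtain ⟨u, B, hB, hφ⟩ := h
  cases hB with
  | @aliasFree _ _ _ _ π' _ m Q hπ hstep =>
    have hπ' : π' = .inp (.var (d + n)) N := by
      cases π' with
      | inp M' N' =>
        have hinj := Act.inp.inj hπ
        have hM : M' = .var (d + n) := Msg.emb_injective hinj.1.symm
        have hN : N' = N := Msg.emb_injective (hinj.2.symm.trans hU)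
        rw [hM, hN]
      | _ => cases hπ
    subst hπ'
    obtain ⟨S', hS', hr⟩ := hP.actIn hstep rfl
    simp only [add_assoc] at hr
    exact ⟨m, S', Q, hS', hr, hφ⟩

theorem sat_diaInp_of {S' : Multiset Thread} {U : Recipe} {N : Msg ℕ} {φ : Form} {m : ℕ}
    (hP : Repr (c + n) (d + n) (e + n) S P) (hU : (U.lift n).app σ = N.emb)
    (h : ActIn (c + n) (d + n) (e + n) S (.inp (.var (d + n)) N) m .idn S')
    (hφ : ∀ Q, Repr (c + (n + m)) (d + (n + m)) (e + (n + m)) S' Q →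
      Sat ⟨n + m, σ.shift m, Q⟩ φ) :
    Sat ⟨n, σ, P⟩ (.diaInp (v d) U φ) := by
  obtain ⟨l, Q, hQ, hr⟩ := h.step hP
  simp only [add_assoc] at hr
  rw [Sat]
  exact ⟨_, _, .aliasFree (π' := .inp (.var (d + n)) N) (congrArg (Act.inp _) hU) hQ, hφ Q hr⟩

theorem sat_diaOut {φ : Form} (hP : Repr (c + n) (d + n) (e + n) S P)
    (h : Sat ⟨n, σ, P⟩ (.diaOut (v c) φ)) :
    ∃ a l w m S' Q, a ∉ σ.dom ∧
      ActIn (c + n) (d + n) (e + n) S (.out (.var (c + n)) (root l)) m (.single (root l) w) S' ∧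
      Repr (c + (n + m)) (d + (n + m)) (e + (n + m)) S' Q ∧
      Sat ⟨n + m, (σ.shift m).update a w, Q⟩ (φ.inst a) := by
  rw [Sat] at h
  obtain ⟨a, u, B, hB, -, hφ⟩ := h
  cases hB with
  | @aliasOut _ _ _ _ M' w l s _ m Q hM hdom hstep =>
    have hM' : M' = .var (c + n) := Msg.emb_injective hM.symm
    subst hM'
    obtain ⟨S', hS', hr⟩ := hP.actIn hstep rfl
    simp only [add_assoc] at hr
    exact ⟨_, l, w, m, S', Q, hdom, hS', hr, hφ⟩
  -- This rule requires the identity as active substitution of the step, whereas an output always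
  -- stores a message.
  | @aliasFree _ _ _ _ π' _ m Q hπ hstep =>
    cases π' with
    | out M' b =>
      have hM' : M' = .var (c + n) := Msg.emb_injective (Act.out.inj hπ).1.symm
      subst hM'
      obtain ⟨S', hS', -⟩ := hP.actIn hstep rfl
      obtain ⟨w, hw, -⟩ := hS'.of_out
      exact absurd hw.symm (Frame.single_ne_idn _ _)
    | _ => cases hπ

theorem sat_diaOut_of {S' : Multiset Thread} {w : Msg ℕ} {φ : Form} {m : ℕ}
    (hP : Repr (c + n) (d + n) (e + n) S P)
    (h : ∀ l, ActIn (c + n) (d + n) (e + n) S (.out (.var (c + n)) (root l)) m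
      (.single (root l) w) S')
    (hφ : ∀ a Q, a ∉ σ.dom → Repr (c + (n + m)) (d + (n + m)) (e + (n + m)) S' Q →
      Sat ⟨n + m, (σ.shift m).update a w, Q⟩ (φ.inst a)) :
    Sat ⟨n, σ, P⟩ (.diaOut (v c) φ) := by
  obtain ⟨l, hl⟩ := exists_root_not_mem (σ.finite_dom.union φ.finite_fal)
  obtain ⟨⟨s, t⟩, Q, hQ, hr⟩ := (h l).step hP
  simp only [add_assoc] at hr
  have hs := hl s
  rw [Set.mem_union, not_or] at hs
  rw [Sat]
  exact ⟨_, _, _, .aliasOut (M' := .var (c + n)) rfl hs.1 hQ, hs.2, hφ _ Q hs.1 hr⟩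

theorem sat_neg {A : Ext} {φ : Form} : Sat A φ.neg ↔ ¬ Sat A φ := by rw [Sat]

theorem sat_and {A : Ext} {φ ψ : Form} : Sat A (φ.and ψ) ↔ Sat A φ ∧ Sat A ψ := by rw [Sat]

theorem sat_eq_alias {a : Alias} {N : Msg ℕ} (h : σ.toFun a = some N) :
    Sat ⟨n, σ, P⟩ (.eq (.var (.inr a)) (v e)) ↔ EqE N (.var (e + n)) := by
  rw [Sat, ← eqE_emb_iff, ← Frame.val_of_eq_some h]
  rfl

/-- A thread of positive weight either waits, and rejects the variable it is sent, or has already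
read a bad message. In the second case the input must be absorbed elsewhere, by a verifier freshly
unfolded from the top-level replication; hence the assumption on `repl b`. -/
theorem exists_reject {b : Bool} (hb : repl b ∈ S) (h : total errors S ≠ 0) (x : ℕ) :
    ∃ m S' k i y, ActIn c d e S (.inp (.var d) (.var x)) m .idn S' ∧
      proOut k i y ∈ S' ∧ ¬ EqE (.var i) (.snd (.dec y (.var k))) := by
  obtain ⟨t, ht, hne⟩ := exists_pos_of_total_pos h
  obtain ⟨R, rfl⟩ := Multiset.exists_cons_of_mem ht
  cases t with
  | proIn k i =>
    exact ⟨_, _, k, i, _, ⟨_, R, _, rfl, .proIn k i (.var x), rfl⟩, by simp,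
      not_eqE_snd_dec_var i x k⟩
  | proOut k i y =>
    have hb' : repl b ∈ R := by simpa using hb
    obtain ⟨R, rfl⟩ := Multiset.exists_cons_of_mem hb'
    have hi : ¬ EqE (.var i) (.snd (.dec y (.var k))) := by simpa [errors] using hne
    have hfresh : ∃ T, Thread.Act c d e (fresh b) (.inp (.var d) (.var x)) 1 .idn T := by
      cases b
      · exact ⟨_, .fresh (s := ver 0) (S := {pro 0}) rfl (.ver 0 _)⟩
      · exact ⟨_, .fresh (s := sessions 0) (S := 0) rfl
          (.unfold (s := ver 0) (S := {pro 0, sessions 0}) rfl (.ver 0 _))⟩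
    obtain ⟨T, hT⟩ := hfresh
    have hact : Thread.Act c d e (repl b) (.inp (.var d) (.var x)) 1 .idn _ :=
      .unfold (s := fresh b) (S := {repl b}) rfl hT
    refine ⟨1, _, k + 1, i + 1, y.map (· + 1), ⟨repl b, proOut k i y ::ₘ R, _,
      Multiset.cons_swap _ _ _, hact, rfl⟩, ?_, ?_⟩
    · exact Multiset.mem_add.2 (.inr (Multiset.mem_map.2 ⟨_, Multiset.mem_cons_self _ _, rfl⟩))
    · rwa [accept_shift_iff]
  | _ => exact absurd rfl hne

theorem inst_ne_error (a : Alias) (e : ℕ) :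
    (Form.neg (.ne (v 0) (v (e + 1)))).inst a = .neg (.neg (.eq (.var (.inr a)) (v e))) := rfl

theorem total_errors_of_sat_noError {z : ℕ} {b : Bool} (hP : Repr (c + n) (d + n) (e + n) S P)
    (hb : repl b ∈ S) (h : Sat ⟨n, σ, P⟩ (noError e c d z)) : total errors S = 0 := by
  by_contra hne
  obtain ⟨m, S', k, i, y, hact, hmem, hE⟩ :=
    exists_reject (c := c + n) (d := d + n) (e := e + n) hb hne (z + n)
  refine sat_neg.1 h (sat_diaInp_of (U := v z) (N := .var (z + n)) hP rfl hact fun Q hQ => ?_)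
  rw [sat_neg, Form.boxOut, sat_neg, not_not]
  obtain ⟨R, rfl⟩ := Multiset.exists_cons_of_mem hmem
  refine sat_diaOut_of hQ (fun l => ⟨_, R, _, rfl, .proOut_reject k i y l hE, rfl⟩)
    fun a Q' ha hQ' => ?_
  rw [inst_ne_error, sat_neg, sat_neg, not_not, sat_eq_alias (Frame.update_self _ _ _)]
  exact .refl _

/-- Reading a variable leaves the total of `errors` at zero, and an error output would have to lower
it. The other outputs are ciphertexts or fresh nonces, never equal to the error variable. -/
theorem sat_noError {z : ℕ} (hP : Repr (c + n) (d + n) (e + n) S P) (h : total errors S = 0) :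
    Sat ⟨n, σ, P⟩ (noError e c d z) := by
  rw [noError, Form.boxInp, sat_neg]
  intro hsat
  obtain ⟨m, S', Q, hact, hQ, hsat⟩ := sat_diaInp (N := .var (z + n)) hP rfl hsat
  have hS' : total errors S' = 0 := by
    rcases hact.of_inp with h' | ⟨k, i, -, h'⟩
    · rw [h'.1, h]
    · exact absurd h' (not_eqE_snd_dec_var _ _ _)
  rw [sat_neg, Form.boxOut, sat_neg, not_not] at hsat
  obtain ⟨a, l, w, m', S'', Q', ha, hact, hQ', hsat⟩ := sat_diaOut hQ hsat
  rw [inst_ne_error, sat_neg, sat_neg, not_not, sat_eq_alias (Frame.update_self _ _ _)] at hsat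
  obtain ⟨w', hw, h⟩ := hact.of_out
  obtain ⟨-, rfl⟩ := Frame.single_injective hw
  rcases h with ⟨k, N, R, -, -, rfl, -⟩ | ⟨N, K, rfl, -⟩ | ⟨-, h, -⟩ | ⟨rfl, hm, -⟩
  · exact not_eqE_enc_var _ _ _ hsat
  · exact not_eqE_enc_var _ _ _ hsat
  · omega
  · have := eqE_var_iff.1 hsat
    omega

end APi

-- Instantiating the attack formula and evaluating its branches.

namespace APi
open Thread

namespace Form

/-- A parameter of the form `x + k + 1` is a free variable lying above the removed binder `k`, so
instantiation lowers it by one and touches nothing else. -/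
theorem noError_instAt (a : Alias) (e c d z k : ℕ) :
    (noError (e + k + 1) (c + k + 1) (d + k + 1) (z + k + 1)).instAt a k =
      noError (e + k) (c + k) (d + k) (z + k) := by
  have h (x : ℕ) : ¬ x + k + 1 < k ∧ x + k + 1 ≠ k ∧ ¬ x + k + 1 + 1 < k + 1 := by omega
  simp [noError, boxInp, boxOut, ne, instAt, v, Msg.map, Msg.bind, instAt.at_, h]

/-- `⟨d U⟩⟨c̄(w)⟩(w ≠ err ∧ [d z][c̄(v)](v ≠ err))`. -/
def authBranchOf (err c d z : ℕ) (U : Recipe) : Form :=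
  .diaInp (v d) U (.diaOut (v c)
    (.and (.ne (v 0) (v (err + 1))) (noError (err + 1) (c + 1) (d + 1) (z + 1))))

/-- The conjunction under the modalities of the attack formula. -/
def attackBody (err c d z : ℕ) (U₁ U₂ : Recipe) : Form :=
  .and (.ne U₁ (v err)) (.and (.ne U₂ (v err)) (.and (errorBranch err c d z)
    (.and (authBranchOf err c d z U₁) (authBranchOf err c d z U₂))))

theorem authBranchOf_instAt (a : Alias) (e c d z k : ℕ) (U : Recipe) :
    (authBranchOf (e + k + 1) (c + k + 1) (d + k + 1) (z + k + 1) U).instAt a k =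
      authBranchOf (e + k) (c + k) (d + k) (z + k) (U.map (instAt.at_ a k)) := by
  have h (x : ℕ) : ¬ x + k + 1 < k ∧ x + k + 1 ≠ k ∧ ¬ x + k + 1 + 1 < k + 1 := by omega
  have h' := noError_instAt a e c d z (k + 1)
  simp only [← add_assoc] at h'
  simp [authBranchOf, ne, instAt, h', v, Msg.map, Msg.bind, instAt.at_, h]

theorem errorBranch_instAt (a : Alias) (e c d z k : ℕ) :
    (errorBranch (e + k + 1) (c + k + 1) (d + k + 1) (z + k + 1)).instAt a k =
      errorBranch (e + k) (c + k) (d + k) (z + k) := by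
  have h (x : ℕ) : ¬ x + k + 1 < k ∧ x + k + 1 ≠ k ∧ ¬ x + k + 1 + 1 < k + 1 := by omega
  have h' := noError_instAt a e c d z (k + 1)
  simp only [← add_assoc] at h'
  simp [errorBranch, instAt, h', v, Msg.map, Msg.bind, instAt.at_, h]

theorem attackBody_instAt (a : Alias) (e c d z k : ℕ) (U₁ U₂ : Recipe) :
    (attackBody (e + k + 1) (c + k + 1) (d + k + 1) (z + k + 1) U₁ U₂).instAt a k =
      attackBody (e + k) (c + k) (d + k) (z + k) (U₁.map (instAt.at_ a k))
        (U₂.map (instAt.at_ a k)) := by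
  have h (x : ℕ) : ¬ x + k + 1 < k ∧ x + k + 1 ≠ k := by omega
  simp [attackBody, ne, instAt, authBranchOf_instAt, errorBranch_instAt, v, Msg.map, Msg.bind,
    instAt.at_, h]

/-- The attack formula after its first output, of the alias `a`. -/
theorem attack_inst (a : Alias) (e c d z : ℕ) :
    (Form.diaInp (v (d + 1)) (v 0) (.diaInp (v (d + 1)) (v 0) (.diaOut (v (c + 1))
      (.diaOut (v (c + 2)) (attackBody (e + 3) (c + 3) (d + 3) (z + 3) (v 1) (v 0)))))).inst a =
    .diaInp (v d) (.var (.inr a)) (.diaInp (v d) (.var (.inr a)) (.diaOut (v c)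
      (.diaOut (v (c + 1)) (attackBody (e + 2) (c + 2) (d + 2) (z + 2) (v 1) (v 0))))) := by
  have h := attackBody_instAt a e c d z 2 (v 1) (v 0)
  simp only [inst, instAt, h]
  rfl

theorem attackBody_inst (a₁ a₂ : Alias) (e c d z : ℕ) :
    ((Form.diaOut (v (c + 1)) (attackBody (e + 2) (c + 2) (d + 2) (z + 2) (v 1) (v 0))).inst a₁ =
      .diaOut (v c) (attackBody (e + 1) (c + 1) (d + 1) (z + 1) (.var (.inr a₁)) (v 0))) ∧
    (attackBody (e + 1) (c + 1) (d + 1) (z + 1) (.var (.inr a₁)) (v 0)).inst a₂ =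
      attackBody e c d z (.var (.inr a₁)) (.var (.inr a₂)) := by
  have h := attackBody_instAt a₁ e c d z 1 (v 1) (v 0)
  have h' := attackBody_instAt a₂ e c d z 0 (.var (.inr a₁)) (v 0)
  refine ⟨?_, ?_⟩
  · simp only [inst, instAt, h]
    rfl
  · exact h'

theorem eq_error_and_noError_inst (a : Alias) (e c d z : ℕ) :
    (Form.and (.eq (v 0) (v (e + 1))) (noError (e + 1) (c + 1) (d + 1) (z + 1))).inst a =
      .and (.eq (.var (.inr a)) (v e)) (noError e c d z) := by
  have h := noError_instAt a e c d z 0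
  simp only [inst, instAt]
  exact congrArg _ h

theorem ne_error_and_noError_inst (a : Alias) (e c d z : ℕ) :
    (Form.and (.ne (v 0) (v (e + 1))) (noError (e + 1) (c + 1) (d + 1) (z + 1))).inst a =
      .and (.ne (.var (.inr a)) (v e)) (noError e c d z) := by
  have h := noError_instAt a e c d z 0
  simp only [inst, instAt]
  exact congrArg _ h

end Form

open Form

variable {c d e n : ℕ} {S : Multiset Thread} {P : Proc} {σ : Frame}

/-- The input preserves the total, the error output lowers it by exactly one, and `noError` says
that it is then zero. -/
theorem total_errors_of_sat_errorBranch {z : ℕ} {b : Bool}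
    (hP : Repr (c + n) (d + n) (e + n) S P) (hb : repl b ∈ S)
    (h : Sat ⟨n, σ, P⟩ (errorBranch e c d z)) : total errors S = 1 := by
  obtain ⟨m, S₁, Q₁, h₁, hQ₁, h⟩ := sat_diaInp (N := .var (z + n)) hP rfl h
  obtain ⟨a, l, w, m', S₂, Q₂, ha, h₂, hQ₂, h⟩ := sat_diaOut hQ₁ h
  rw [eq_error_and_noError_inst, sat_and, sat_eq_alias (Frame.update_self _ _ _)] at h
  obtain ⟨hw, h⟩ := h
  have hS₂ := total_errors_of_sat_noError hQ₂ (h₂.repl_mem (h₁.repl_mem hb)) h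
  have hS₁ : total errors S₁ = total errors S := by
    rcases h₁.of_inp with h' | ⟨k, i, -, h'⟩
    · exact h'.1
    · exact absurd h' (not_eqE_snd_dec_var _ _ _)
  obtain ⟨w', hw', h⟩ := h₂.of_out
  obtain ⟨-, rfl⟩ := Frame.single_injective hw'
  rcases h with ⟨k, N, R, -, -, rfl, -⟩ | ⟨N, K, rfl, -⟩ | ⟨-, h, -⟩ | ⟨rfl, hm, -⟩
  · exact absurd hw (not_eqE_enc_var _ _ _)
  · exact absurd hw (not_eqE_enc_var _ _ _)
  · omega
  · have := eqE_var_iff.1 hw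
    omega

/-- The total must fall to zero, yet no output other than an error lowers it. So the input itself
must have lowered it, and only an acceptance by a waiting prover does so. -/
theorem exists_proIn_of_sat_authBranch {z : ℕ} {b : Bool} {U : Recipe} {N : Msg ℕ}
    (hP : Repr (c + n) (d + n) (e + n) S P) (hb : repl b ∈ S) (hS : total errors S ≠ 0)
    (hU : (U.lift n).app σ = N.emb) (h : Sat ⟨n, σ, P⟩ (authBranchOf e c d z U)) :
    ∃ k i, proIn k i ∈ S ∧ EqE (.var i) (.snd (.dec N (.var k))) := by
  obtain ⟨m, S₁, Q₁, h₁, hQ₁, h⟩ := sat_diaInp hP hU h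
  obtain ⟨a, l, w, m', S₂, Q₂, ha, h₂, hQ₂, h⟩ := sat_diaOut hQ₁ h
  rw [ne_error_and_noError_inst, sat_and, Form.ne, sat_neg,
    sat_eq_alias (Frame.update_self _ _ _)] at h
  obtain ⟨hw, h⟩ := h
  have hS₂ := total_errors_of_sat_noError hQ₂ (h₂.repl_mem (h₁.repl_mem hb)) h
  rcases h₁.of_inp with h' | h'
  · obtain ⟨w', hw', h⟩ := h₂.of_out
    obtain ⟨-, rfl⟩ := Frame.single_injective hw'
    rcases h with ⟨k, N, R, hS₁, rfl, -, rfl⟩ | ⟨N, K, rfl, h, -⟩ | ⟨rfl, -⟩ | ⟨-, -, h, -⟩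
    · subst hS₁
      simp [errors] at h' hS₂
      omega
    · omega
    · exact absurd (eqE_var_iff.2 (by omega)) hw
    · omega
  · exact h'

theorem sat_errorBranch {z k i : ℕ} {R : Multiset Thread}
    (hP : Repr (c + n) (d + n) (e + n) (proIn k i ::ₘ R) P) (hR : total errors R = 0) :
    Sat ⟨n, σ, P⟩ (errorBranch e c d z) := by
  refine sat_diaInp_of (N := .var (z + n)) hP rfl ⟨_, R, _, rfl, .proIn k i _, rfl⟩ fun Q hQ => ?_
  refine sat_diaOut_of hQ (fun l => ⟨proOut k i _, shiftAll 0 R, _, Multiset.singleton_add _ _,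
    .proOut_reject k i _ l (not_eqE_snd_dec_var _ _ _), rfl⟩) fun a Q' ha hQ' => ?_
  rw [eq_error_and_noError_inst, sat_and, sat_eq_alias (Frame.update_self _ _ _)]
  exact ⟨.refl _, sat_noError hQ' (by simp [errors, hR])⟩

theorem sat_authBranch {z k i : ℕ} {R : Multiset Thread} {U : Recipe} {N : Msg ℕ}
    (hP : Repr (c + n) (d + n) (e + n) (proIn k i ::ₘ R) P) (hR : total errors R = 0)
    (hU : (U.lift n).app σ = N.emb) (hN : EqE (.var i) (.snd (.dec N (.var k)))) :
    Sat ⟨n, σ, P⟩ (authBranchOf e c d z U) := by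
  refine sat_diaInp_of hP hU ⟨_, R, _, rfl, .proIn k i _, rfl⟩ fun Q hQ => ?_
  refine sat_diaOut_of hQ (fun l => ⟨proOut k i _, shiftAll 0 R, _, Multiset.singleton_add _ _,
    .proOut_accept k i _ l hN, rfl⟩) fun a Q' ha hQ' => ?_
  rw [ne_error_and_noError_inst, sat_and, Form.ne, sat_neg,
    sat_eq_alias (Frame.update_self _ _ _)]
  exact ⟨not_eqE_enc_var _ _ _, sat_noError hQ' (by simp [errors, hR])⟩

theorem sat_ne_error {a : Alias} {M K : Msg ℕ} (h : σ.toFun a = some (.enc M K)) :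
    Sat ⟨n, σ, P⟩ (.ne (.var (.inr a)) (v e)) := by
  rw [Form.ne, sat_neg, sat_eq_alias h]
  exact not_eqE_enc_var _ _ _

end APi

-- The attack on the system and its impossibility in the specification.

namespace APi
open Thread Form

theorem alias_app {n : ℕ} {σ : Frame} {a : Alias} {N : Msg ℕ} (h : σ.toFun a = some N) :
    (Msg.lift n (.var (.inr a))).app σ = N.emb := Frame.val_of_eq_some h

theorem sat_system_attack (e c d z : ℕ) : Sat (system e c d).toExt (attack e c d z) := by
  have h₀ : Repr (c + 0) (d + 0) (e + 0) {repl true} (system e c d) := .thread _ rfl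
  -- One key is opened and a prover for it sends its nonce. The two new names are the nonce, at
  -- index `0`, and the key, at index `1`.
  refine sat_diaOut_of (m := 2) (w := .var 0) h₀ (fun l => Thread.Act.actIn
    (.unfold (s := fresh true) (S := {repl true}) rfl
      (.fresh (s := sessions 0) (S := 0) rfl
        (.unfold (s := pro 0) (S := {ver 0, sessions 0}) (Multiset.cons_swap (ver 0) (pro 0) {sessions 0})
          (.pro 0 l))))) fun a P₁ _ h₁ => ?_
  refine (congrArg (Sat _) (attack_inst a e c d z)).mpr ?_
  have ha := Frame.update_self (Frame.idn.shift 2) a (.var 0)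
  replace h₁ : Repr (c + 2) (d + 2) (e + 2)
      {ver 1, proIn 1 0, sessions 1, repl true} P₁ := by
    convert h₁ using 1
    simp only [shiftAll, Multiset.insert_eq_cons, Multiset.map_cons, Multiset.map_singleton,
      Multiset.map_zero, shift, Nat.reduceAdd]
    simp only [← Multiset.singleton_add]
    abel
  refine sat_diaInp_of (m := 0) h₁ (alias_app ha)
    ⟨_, _, _, rfl, .ver 1 _, rfl⟩ fun P₂ h₂ => ?_
  have ha := Frame.shift_eq_some ha 0
  replace h₂ : Repr (c + 2) (d + 2) (e + 2)
      {sessions 1, verOut 1 (.var 0), proIn 1 0, repl true} P₂ := by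
    convert h₂ using 1
    simp only [shiftAll, Multiset.insert_eq_cons, Multiset.map_cons, Multiset.map_singleton,
      shift, Msg.map, Nat.reduceAdd]
    simp only [← Multiset.singleton_add]
    abel
  -- The second input is read by another verifier with the same key `1`, unfolded from `sessions 1`.
  -- The specification has no counterpart of this move.
  refine sat_diaInp_of (m := 0) h₂ (alias_app ha)
    ⟨_, _, _, rfl, .unfold (s := ver 1) (S := {pro 1, sessions 1}) rfl (.ver 1 _), rfl⟩
    fun P₃ h₃ => ?_
  replace h₃ : Repr (c + 2) (d + 2) (e + 2)
      {verOut 1 (.var 0), verOut 1 (.var 0), proIn 1 0, pro 1, sessions 1, repl true} P₃ := by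
    convert h₃ using 1
    simp only [shiftAll, Multiset.insert_eq_cons, Multiset.map_cons, Multiset.map_singleton,
      shift, Msg.map, Msg.bind, Nat.reduceAdd]
    simp only [← Multiset.singleton_add]
    abel
  refine sat_diaOut_of (m := 1) h₃ (fun l => ⟨_, _, _, rfl, .verOut 1 _ l, rfl⟩)
    fun a₁ P₄ _ h₄ => ?_
  -- In the first answer, index `0` is the verifier's new nonce, `1` the prover's nonce and `2` the
  -- key. The second answer creates another name, which moves the prover's nonce to `2` and the key
  -- to `3`.
  have ha₁ := Frame.update_self
    (((((Frame.idn.shift 2).update a (.var 0)).shift 0).shift 0).shift 1) a₁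
    (.enc (.pair (.var 0) (.var 1)) (.var 2))
  refine (congrArg (Sat _) (attackBody_inst a₁ a₁ e c d z).1).mpr ?_
  replace h₄ : Repr (c + 3) (d + 3) (e + 3)
      {verOut 2 (.var 1), verDone 2, proIn 2 1, pro 2, sessions 2, repl true} P₄ := by
    convert h₄ using 1
    simp only [shiftAll, Multiset.insert_eq_cons, Multiset.map_cons, Multiset.map_singleton,
      shift, Msg.map, Msg.bind, Nat.reduceAdd]
    simp only [← Multiset.singleton_add]
    abel
  refine sat_diaOut_of (m := 1) h₄ (fun l => ⟨_, _, _, rfl, .verOut 2 _ l, rfl⟩)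
    fun a₂ P₅ ha₂ h₅ => ?_
  replace ha₁ := Frame.update_shift_eq_some (m := 1)
    (M := .enc (.pair (.var 0) (.var 2)) (.var 3)) ha₁ ha₂
  have ha₂ := Frame.update_self
    ((((((((Frame.idn.shift 2).update a (.var 0)).shift 0).shift 0).shift 1).update a₁
    (.enc (.pair (.var 0) (.var 1)) (.var 2)))).shift 1) a₂
    (.enc (.pair (.var 0) (.var 2)) (.var 3))
  refine (congrArg (Sat _) (attackBody_inst a₁ a₂ e c d z).2).mpr ?_
  replace h₅ : Repr (c + 4) (d + 4) (e + 4)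
      (proIn 3 2 ::ₘ {verDone 3, verDone 3, pro 3, sessions 3, repl true}) P₅ := by
    convert h₅ using 1
    simp only [shiftAll, Multiset.insert_eq_cons, Multiset.map_cons, Multiset.map_singleton,
      shift, Msg.map, Nat.reduceAdd]
    simp only [← Multiset.singleton_add]
    abel
  -- The prover `proIn 3 2` is the only thread of positive weight. The conjuncts are tested on the
  -- same state, so this one prover can reject `z` in one and accept either answer in the others.
  have hR : total errors {verDone 3, verDone 3, pro 3, sessions 3, repl true} = 0 := by
    simp [errors]
  simp only [attackBody, sat_and]
  exact ⟨sat_ne_error ha₁, sat_ne_error ha₂, sat_errorBranch h₅ hR,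
    sat_authBranch h₅ hR (alias_app ha₁) (eqE_snd_dec_enc _ _ _),
    sat_authBranch h₅ hR (alias_app ha₂) (eqE_snd_dec_enc _ _ _)⟩

theorem not_sat_spec_attack (e c d z : ℕ) : ¬ Sat (spec e c d).toExt (attack e c d z) := by
  intro h
  have h₀ : Repr (c + 0) (d + 0) (e + 0) {repl false} (spec e c d) := .thread _ rfl
  have hb₀ : repl false ∈ ({repl false} : Multiset Thread) := by simp
  have hs₀ : AreSingle {repl false} := ⟨by simp [IsSingle], by simp [verifiers]⟩
  obtain ⟨a, l, w, m₁, S₁, P₁, -, hact, h₁, h⟩ := sat_diaOut h₀ h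
  replace h := (congrArg (Sat _) (attack_inst a e c d z)).mp h
  have hb₁ := hact.repl_mem hb₀
  have hs₁ := hact.areSingle hs₀
  obtain ⟨w', hw', hcases⟩ := hact.of_out
  obtain ⟨-, rfl⟩ := Frame.single_injective hw'
  -- No thread is active at the start, so the first output can only be a prover's nonce.
  obtain ⟨rfl, he₁, hc₁⟩ : w = .var 0 ∧ total errors S₁ = 1 ∧ total accepts S₁ = 0 := by
    rcases hcases with ⟨k, N, R, hS, -⟩ | ⟨N, K, -, -, h⟩ | ⟨-, h, -⟩ | ⟨rfl, -, h, h'⟩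
    · have hmem : verOut k N ∈ ({repl false} : Multiset Thread) := by simp [hS]
      simp at hmem
    · simp [accepts] at h
    · simp [errors] at h
    · exact ⟨rfl, by simpa [errors] using h, by simpa [accepts] using h'⟩
  have ha := Frame.update_self (Frame.idn.shift m₁) a (.var 0)
  obtain ⟨m₂, S₂, P₂, hact, h₂, h⟩ := sat_diaInp h₁ (alias_app ha) h
  have hb₂ := hact.repl_mem hb₁
  have hs₂ := hact.areSingle hs₁
  -- The message `nt₁` is a variable, which no prover accepts; so the counts survive this input and
  -- the next one.
  obtain ⟨he₂, hc₂⟩ := hact.of_inp.resolve_right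
    fun ⟨_, _, _, h⟩ => not_eqE_snd_dec_var _ _ _ h
  replace ha := Frame.shift_eq_some ha m₂
  obtain ⟨m₃, S₃, P₃, hact, h₃, h⟩ := sat_diaInp h₂ (alias_app ha) h
  have hb₃ := hact.repl_mem hb₂
  have hs₃ := hact.areSingle hs₂
  obtain ⟨he₃, hc₃⟩ := hact.of_inp.resolve_right
    fun ⟨_, _, _, h⟩ => not_eqE_snd_dec_var _ _ _ h
  obtain ⟨a₁, l₁, w₁, m₄, S₄, P₄, -, hact₁, h₄, h⟩ := sat_diaOut h₃ h
  rw [(attackBody_inst a₁ a₁ e c d z).1] at h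
  have hb₄ := hact₁.repl_mem hb₃
  have hs₄ := hact₁.areSingle hs₃
  obtain ⟨a₂, l₂, w₂, m₅, S₅, P₅, ha₂, hact₂, h₅, h⟩ := sat_diaOut h₄ h
  rw [(attackBody_inst a₁ a₂ e c d z).2] at h
  have hb₅ := hact₂.repl_mem hb₄
  have hw₁ := Frame.update_shift_eq_some (m := m₅) (M := w₂) (Frame.update_self _ a₁ w₁) ha₂
  simp only [attackBody, sat_and] at h
  obtain ⟨hne₁, hne₂, herr, hauth₁, hauth₂⟩ := h
  have he₅ := total_errors_of_sat_errorBranch h₅ hb₅ herr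
  rw [Form.ne, sat_neg, sat_eq_alias hw₁] at hne₁
  rw [Form.ne, sat_neg, sat_eq_alias (Frame.update_self _ _ _)] at hne₂
  obtain ⟨w', hw', hout₁⟩ := hact₁.of_out
  obtain ⟨-, rfl⟩ := Frame.single_injective hw'
  obtain ⟨w', hw', hout₂⟩ := hact₂.of_out
  obtain ⟨-, rfl⟩ := Frame.single_injective hw'
  have hnot₁ (x : ℕ) (hx : w₁ = .var x) (hx' : x = e + (0 + m₁ + m₂ + m₃) + m₄) : False := by
    subst hx
    refine hne₁ (eqE_var_iff.2 ?_)
    dsimp only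
    omega
  have hnot₂ (x : ℕ) (hx : w₂ = .var x) (hx' : x = e + (0 + m₁ + m₂ + m₃ + m₄) + m₅) :
      False := by
    subst hx
    exact hne₂ (eqE_var_iff.2 (by omega))
  -- Nothing has been accepted and errors are excluded, which leaves a nonce as the alternative. It
  -- would raise the total to two, and the second output, not being an error either, could not bring
  -- it back to one.
  obtain ⟨k₁, N₁, R₁, rfl, rfl, rfl, rfl⟩ := hout₁.resolve_right (by
    rintro (⟨N, K, -, -, h⟩ | ⟨h, -⟩ | ⟨-, -, h, h'⟩)
    · omega
    · exact hnot₁ _ h rfl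
    · rcases hout₂ with ⟨k, N, R, rfl, rfl, -, rfl⟩ | ⟨N, K, -, -, h⟩ | ⟨h, -⟩ | ⟨-, -, h'', -⟩
      · simp [errors] at he₅ h
        omega
      · omega
      · exact hnot₂ _ h rfl
      · omega)
  have he₄ : total errors (verDone (k₁ + 1) ::ₘ shiftAll 1 R₁) =
      total errors (verOut k₁ N₁ ::ₘ R₁) := by simp [errors]
  have hc₄ : total accepts (verDone (k₁ + 1) ::ₘ shiftAll 1 R₁) =
      total accepts (verOut k₁ N₁ ::ₘ R₁) := by simp [accepts]
  obtain ⟨k₂, N₂, R₂, hS₄, rfl, rfl, rfl⟩ := hout₂.resolve_right (by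
    rintro (⟨N, K, -, -, h⟩ | ⟨h, -⟩ | ⟨-, -, h, h'⟩)
    · omega
    · exact hnot₂ _ h rfl
    · omega)
  obtain ⟨k, i, hmem, hk⟩ := exists_proIn_of_sat_authBranch h₅ hb₅ (by omega)
    (alias_app hw₁) hauth₁
  obtain ⟨k', i', hmem', hk'⟩ := exists_proIn_of_sat_authBranch h₅ hb₅ (by omega)
    (alias_app (Frame.update_self _ _ _)) hauth₂
  -- The first key has been shifted past the nonces of both verifiers, the second only past its own;
  -- hence `k₁ + 1` is to be compared with `k₂`.
  have hkey : k₁ + 1 + 1 = k := key_eq_of_eqE_snd_dec_enc hk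
  have hkey' : k₂ + 1 = k' := key_eq_of_eqE_snd_dec_enc hk'
  have hne : k₁ + 1 ≠ k₂ := by
    rintro rfl
    -- The finished verifier still counts for its key, as `verDone` remembers it; with equal keys
    -- there would be two verifiers for one key.
    have hle := add_le_total (w := verifiers (k₁ + 1)) (s := verDone (k₁ + 1)) (t := verOut (k₁ + 1) N₂)
      (Multiset.mem_cons_self _ (shiftAll 1 R₁)) (hS₄ ▸ Multiset.mem_cons_self _ _) (by simp)
    have := hs₄.2 (k₁ + 1)
    simp only [verifiers, if_true] at hle
    omega
  -- The two accepting provers have different keys, hence are distinct threads, each of weight one,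
  -- although the total is one.
  have hle := add_le_total (w := errors) hmem hmem' (by
    simp only [ne_eq, proIn.injEq]
    omega)
  simp only [errors] at hle
  omega

end APi

-- Bisimilar extended processes satisfy the same formulas.

namespace APi

theorem Msg.ren_congr {ρ ρ' : Alias → Alias} {M : Recipe} (h : Set.EqOn ρ ρ' M.fal) :
    M.ren ρ = M.ren ρ' := by
  refine Msg.bind_congr fun x hx => ?_
  cases x with
  | inl i => rfl
  | inr a => simp [h hx]

theorem Msg.ren_ren (ρ ρ' : Alias → Alias) (M : Recipe) :
    (M.ren ρ).ren ρ' = M.ren (ρ' ∘ ρ) := by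
  simp only [ren, map_map]
  congr 1
  funext x
  cases x <;> rfl

theorem Msg.ren_id (M : Recipe) : M.ren id = M := by
  simp only [ren, Sum.map_id_id]
  exact Msg.map_id' M

theorem Msg.fal_ren (ρ : Alias → Alias) (M : Recipe) : (M.ren ρ).fal = ρ '' M.fal := by
  ext a
  simp [fal, ren, atoms_map]

theorem Msg.ren_map_at (ρ : Alias → Alias) (a : Alias) (k : ℕ) (M : Recipe) :
    (M.map (Form.instAt.at_ a k)).ren ρ = (M.ren ρ).map (Form.instAt.at_ (ρ a) k) := by
  simp only [ren, map_map]
  congr 1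
  funext x
  rcases x with i | b
  · simp only [Form.instAt.at_, Sum.map_inl, id]
    split_ifs <;> rfl
  · rfl

theorem Msg.fal_map_at (a : Alias) (k : ℕ) (M : Recipe) :
    (M.map (Form.instAt.at_ a k)).fal ⊆ insert a M.fal := by
  intro b hb
  simp only [fal, atoms_map, Set.mem_ofPred_eq] at hb
  obtain ⟨x, hx, hxb⟩ := hb
  rcases x with i | b'
  · simp only [Form.instAt.at_] at hxb
    split_ifs at hxb
    simp_all
  · simp only [Form.instAt.at_, Sum.inr.injEq] at hxb
    subst hxb
    exact .inr hx

namespace Form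

/-- Renaming of the aliases of a formula. -/
def ren (ρ : Alias → Alias) : Form → Form
  | tru => tru
  | eq M N => eq (M.ren ρ) (N.ren ρ)
  | and φ ψ => and (φ.ren ρ) (ψ.ren ρ)
  | neg φ => neg (φ.ren ρ)
  | diaInp M N φ => diaInp (M.ren ρ) (N.ren ρ) (φ.ren ρ)
  | diaTau φ => diaTau (φ.ren ρ)
  | diaOut M φ => diaOut (M.ren ρ) (φ.ren ρ)

theorem size_ren (ρ : Alias → Alias) (φ : Form) : (φ.ren ρ).size = φ.size := by
  induction φ <;> simp_all [ren, size]

theorem ren_congr {ρ ρ' : Alias → Alias} {φ : Form} (h : Set.EqOn ρ ρ' φ.fal) :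
    φ.ren ρ = φ.ren ρ' := by
  induction φ with
  | tru => rfl
  | eq M N =>
    exact congrArg₂ eq (Msg.ren_congr (h.mono Set.subset_union_left))
      (Msg.ren_congr (h.mono Set.subset_union_right))
  | and φ ψ ih ih' =>
    exact congrArg₂ and (ih (h.mono Set.subset_union_left)) (ih' (h.mono Set.subset_union_right))
  | neg φ ih => exact congrArg neg (ih h)
  | diaInp M N φ ih =>
    simp only [ren]
    rw [Msg.ren_congr (h.mono (Set.subset_union_left.trans Set.subset_union_left)),
      Msg.ren_congr (h.mono (Set.subset_union_right.trans Set.subset_union_left)),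
      ih (h.mono Set.subset_union_right)]
  | diaTau φ ih => exact congrArg diaTau (ih h)
  | diaOut M φ ih =>
    exact congrArg₂ diaOut (Msg.ren_congr (h.mono Set.subset_union_left))
      (ih (h.mono Set.subset_union_right))

theorem ren_ren (ρ ρ' : Alias → Alias) (φ : Form) : (φ.ren ρ).ren ρ' = φ.ren (ρ' ∘ ρ) := by
  induction φ <;> simp_all [ren, Msg.ren_ren]

theorem ren_id (φ : Form) : φ.ren id = φ := by
  induction φ <;> simp_all [ren, Msg.ren_id]

theorem fal_ren (ρ : Alias → Alias) (φ : Form) : (φ.ren ρ).fal = ρ '' φ.fal := by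
  induction φ <;> simp_all [ren, fal, Msg.fal_ren, Set.image_union]

theorem ren_instAt (ρ : Alias → Alias) (a : Alias) (k : ℕ) (φ : Form) :
    (φ.instAt a k).ren ρ = (φ.ren ρ).instAt (ρ a) k := by
  induction φ generalizing k <;> simp_all [ren, instAt, Msg.ren_map_at]

theorem fal_instAt (a : Alias) (k : ℕ) (φ : Form) : (φ.instAt a k).fal ⊆ insert a φ.fal := by
  induction φ generalizing k with
  | tru => simp [instAt, fal]
  | eq M N =>
    have := Msg.fal_map_at a k M
    have := Msg.fal_map_at a k N
    simp only [instAt, fal]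
    grind
  | and φ ψ ih ih' =>
    have := ih k
    have := ih' k
    simp only [instAt, fal]
    grind
  | neg φ ih => exact ih k
  | diaInp M N φ ih =>
    have := Msg.fal_map_at a k M
    have := Msg.fal_map_at a k N
    have := ih k
    simp only [instAt, fal]
    grind
  | diaTau φ ih => exact ih k
  | diaOut M φ ih =>
    have := Msg.fal_map_at a k M
    have := ih (k + 1)
    simp only [instAt, fal]
    grind

end Form

theorem Frame.dom_shift (σ : Frame) (m : ℕ) : (σ.shift m).dom = σ.dom := by
  ext a
  simp [dom, shift]

theorem Frame.dom_update (σ : Frame) (a : Alias) (N : Msg ℕ) :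
    (σ.update a N).dom = insert a σ.dom := by
  ext b
  by_cases h : b = a
  · simp [dom, update, h]
  · simp [dom, update, h]

theorem GStep.frame_ne_idn {G : Guarded} {M : Msg ℕ} {a : Alias} {t : List Bool} {A : Ext}
    (h : GStep G (.out M a) t A) : A.frame ≠ .idn := by
  generalize hπ : Act.out M a = π at h
  induction h generalizing M with
  | inp => cases hπ
  | out => exact Frame.single_ne_idn _ _
  | mat _ _ ih => exact ih hπ
  | sumL _ ih => exact ih hπ
  | sumR _ ih => exact ih hπ
  | ext _ ih =>
    subst hπ
    exact ih rfl

/-- This rules out deriving an output of an extended process by `aliasFree`, so that every output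
really adds a fresh alias to the domain. -/
theorem Step.frame_ne_idn {P : Proc} {M : Msg ℕ} {a : Alias} {u : LocLabel} {A : Ext}
    (h : Step P (.out M a) u A) : A.frame ≠ .idn := by
  generalize hπ : Act.out M a = π at h
  induction h generalizing M with
  | guarded h =>
    subst hπ
    exact h.frame_ne_idn
  | parL _ ih => exact ih hπ
  | parR _ ih => exact ih hπ
  | ext _ ih =>
    subst hπ
    exact ih rfl
  | mat _ _ ih => exact ih hπ
  | condThen _ _ ih => exact ih hπ
  | condElse _ _ ih => exact ih hπ
  | bang _ ih => exact ih hπ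
  | closeL => cases hπ
  | closeR => cases hπ

theorem Ext.Step.dom_of_out {A B : Ext} {M : Recipe} {a : Alias} {u : LocLabel}
    (h : A.Step (.out M a) u B) : a ∉ A.dom ∧ B.dom = insert a A.dom := by
  cases h with
  | aliasOut _ ha _ => exact ⟨ha, by simp [Ext.dom, Frame.dom_update, Frame.dom_shift]⟩
  | @aliasFree _ _ _ _ π' _ _ _ hπ h =>
    cases π' with
    | out => exact absurd rfl h.frame_ne_idn
    | _ => cases hπ

theorem Ext.Step.dom_of_not_out {A B : Ext} {π : Act (ℕ ⊕ Alias)} {u : LocLabel}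
    (h : A.Step π u B) (hπ : ¬ π.IsOut) : B.dom = A.dom := by
  cases h with
  | aliasOut => exact absurd trivial hπ
  | aliasFree => exact Frame.dom_shift _ _

/-- Related extended processes satisfy the same formulas. -/
theorem IsISimulation.sat_ren {R : (Alias → Alias) → Ext → Ext → Prop} (hR : IsISimulation R)
    (hsymm : IsSymmetric R) (φ : Form) {ρ : Alias → Alias} {A B : Ext} (h : R ρ A B)
    (hφ : φ.fal ⊆ A.dom) (hA : Sat A φ) : Sat B (φ.ren ρ) := by
  -- The output modality passes to an instance of its body, which is not a subformula but has the
  -- same size.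
  induction hn : φ.size using Nat.strong_induction_on generalizing φ ρ A B with
  | _ n ih =>
    subst hn
    cases φ with
    | tru => simp [Form.ren, Sat]
    | eq M N =>
      rw [Sat] at hA
      rw [Form.ren, Sat]
      exact (hR.test ρ A B h M N (Set.subset_union_left.trans hφ)
        (Set.subset_union_right.trans hφ)).1 hA
    | and φ ψ =>
      rw [Sat] at hA
      rw [Form.ren, Sat]
      exact ⟨ih _ (by simp only [Form.size]; omega) φ h (Set.subset_union_left.trans hφ) hA.1 rfl,
        ih _ (by simp only [Form.size]; omega) ψ h (Set.subset_union_right.trans hφ) hA.2 rfl⟩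
    | neg φ =>
      rw [Sat] at hA
      rw [Form.ren, Sat]
      intro hB
      -- Negation is where symmetry enters: satisfaction in `B` is carried back to `A` along an
      -- inverse of `ρ`, which undoes the renaming on the aliases of the formula.
      obtain ⟨ρ', hinv⟩ : ∃ ρ', Set.InvOn ρ' ρ A.dom B.dom :=
        have : Nonempty Alias := ⟨root 0⟩
        ⟨_, (hR.bij ρ A B h).invOn_invFunOn⟩
      have hfal : (φ.ren ρ).fal ⊆ B.dom := by
        rw [Form.fal_ren]
        exact (Set.image_mono hφ).trans (hR.bij ρ A B h).mapsTo.image_subset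
      have hA' := ih _ (by simp only [Form.size, Form.size_ren]; omega) (φ.ren ρ)
        (hsymm ρ ρ' A B h hinv) hfal hB rfl
      have hid : Set.EqOn (ρ' ∘ ρ) id φ.fal := fun a ha => hinv.1 (hφ ha)
      rw [Form.ren_ren, Form.ren_congr hid, Form.ren_id] at hA'
      exact hA hA'
    | diaInp M N φ =>
      rw [Sat] at hA
      rw [Form.ren, Sat]
      obtain ⟨u, A', hstep, hA'⟩ := hA
      obtain ⟨B', u', hstep', h'⟩ := hR.act ρ A B h _ u A' hstep id
      exact ⟨u', B', hstep', ih _ (by simp only [Form.size]; omega) φ h'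
        (hstep.dom_of_not_out id ▸ Set.subset_union_right.trans hφ) hA' rfl⟩
    | diaTau φ =>
      rw [Sat] at hA
      rw [Form.ren, Sat]
      obtain ⟨u, A', hstep, hA'⟩ := hA
      obtain ⟨B', u', hstep', h'⟩ := hR.act ρ A B h _ u A' hstep id
      exact ⟨u', B', hstep', ih _ (by simp only [Form.size]; omega) φ h'
        (hstep.dom_of_not_out id ▸ hφ) hA' rfl⟩
    | diaOut M φ =>
      rw [Sat] at hA
      rw [Form.ren, Sat]
      obtain ⟨a, u, A', hstep, ha, hA'⟩ := hA
      obtain ⟨B', u', a', hstep', h'⟩ := hR.out ρ A B h M a u A' hstep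
      have hφ' : φ.fal ⊆ A.dom := Set.subset_union_right.trans hφ
      -- The alias `a` does not occur in the body, so extending the bijection at `a` affects only
      -- the instantiated variable.
      have hren : φ.ren (Function.update ρ a a') = φ.ren ρ :=
        Form.ren_congr fun b hb => Function.update_of_ne (ne_of_mem_of_not_mem hb ha) _ _
      have hB' := ih _ (by simp only [Form.size, Form.size_inst]; omega) (φ.inst a) h'
        (hstep.dom_of_out.2 ▸ (Form.fal_instAt a 0 φ).trans (Set.insert_subset_insert hφ')) hA' rfl
      rw [Form.inst, Form.ren_instAt, hren, Function.update_self] at hB'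
      -- The aliases of the renamed body lie in the domain of `B`, while an output alias is always
      -- outside it.
      refine ⟨a', u', B', hstep', fun hmem => hstep'.dom_of_out.1 ?_, hB'⟩
      rw [Form.fal_ren] at hmem
      exact ((Set.image_mono hφ').trans (hR.bij ρ A B h).mapsTo.image_subset) hmem

theorem IBisimilar.sat {A B : Ext} (h : IBisimilar A B) {φ : Form} (hφ : φ.fal = ∅)
    (hA : Sat A φ) : Sat B φ := by
  obtain ⟨R, hR, hsymm, h⟩ := h
  simpa [Form.ren_id] using hR.sat_ren hsymm φ h (by simp [hφ]) hA

theorem fal_attack (e c d z : ℕ) : (attack e c d z).fal = ∅ := by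
  simp [attack, errorBranch, authBranch, noError, Form.boxInp, Form.boxOut, Form.ne, Form.fal,
    v, Msg.fal, Msg.atoms]

end APi

theorem mainTheorem7 (c d err : ℕ) (hcd : c ≠ d) (hce : c ≠ err) (hde : d ≠ err) :
    ¬ APi.IBisimilar (APi.system err c d).toExt (APi.spec err c d).toExt ∧
      ∀ z : ℕ, z ≠ c → z ≠ d → z ≠ err →
        APi.Sat (APi.system err c d).toExt (APi.attack err c d z) ∧
          ¬ APi.Sat (APi.spec err c d).toExt (APi.attack err c d z) :=
  -- The index `0` for `z` is an arbitrary choice: a single alias-free formula that separates the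
  -- two processes is enough.
  ⟨fun h => APi.not_sat_spec_attack err c d 0
      (h.sat (APi.fal_attack err c d 0) (APi.sat_system_attack err c d 0)),
    fun z _ _ _ => ⟨APi.sat_system_attack err c d z, APi.not_sat_spec_attack err c d z⟩⟩
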